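/- A conflation category is an additive category $\mathcal{E}$ with a class, closed under isomorphisms, of kernel-cokernel pairs $X \xrightarrow{f} Y \xrightarrow{g} Z$, called conflations; then $f$ is called an inflation and $g$ a deflation. It is deflation-exact if every morphism $X\to 0$ is a deflation, deflations are closed under composition, and pullbacks of deflations along arbitrary morphisms exist and are deflations. A cochain complex $X^\bullet$ in a conflation category is acyclic (exact) if each differential $d^i\colon X^i\to X^{i+1}$ factors as a deflation $X^i \to I^i$ followed by an inflation $I^i\to X^{i+1}$ and $I^i\to X^{i+1}$ is a kernel of $d^{i+1}$. For $*\in\{-,b\}$, let $\mathbf{K}^{*}(\mathcal{E})$ be the homotopy category of bounded above (for $*=-$), respectively bounded (for $*=b$), cochain complexes in $\mathcal{E}$, and let $\mathbf{D}^{*}(\mathcal{E})$ be the Verdier quotient of $\mathbf{K}^{*}(\mathcal{E})$ by the thick closure (the smallest triangulated subcategory closed under direct summands) of the acyclic complexes in it. **Theorem 3.5.** Let $\mathcal{E}$ be a deflation-exact category and let $\mathcal{A}\subseteq\mathcal{E}$ be a full additive subcategory with embedding $\phi\colon\mathcal{A}\to\mathcal{E}$. Regard $\mathcal{A}$ as a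 conflation category: a sequence in $\mathcal{A}$ is a conflation if and only if it is a conflation in $\mathcal{E}$. Call $\mathcal{A}$ preresolving if * for every $E\in\mathcal{E}$ there is a deflation $A\to E$ with $A\in\mathcal{A}$, and * for every conflation $X\to Y\to Z$ in $\mathcal{E}$ with $Y,Z\in\mathcal{A}$ one has $X\in\mathcal{A}$. For $E\in\mathcal{E}$, let $\operatorname{resdim}_{\mathcal{A}}(E)\in\mathbb{N}\cup\{\infty\}$ be the smallest $n\ge 0$ for which there is an exact sequence $0\to A^{-n}\to A^{-n+1}\to\cdots\to A^0\to E\to 0$ in $\mathcal{E}$ with all $A^i\in\mathcal{A}$ (and $\infty$ if there is none). 1. If $\mathcal{A}$ is preresolving, then $\phi$ lifts to a triangle equivalence $\Phi\colon\mathbf{D}^{-}(\mathcal{A})\to\mathbf{D}^{-}(\mathcal{E})$. 2. If $\mathcal{A}$ is preresolving and $\operatorname{resdim}_{\mathcal{A}}(E)<\infty$ for every $E\in\mathcal{E}$, then $\phi$ lifts to a triangle equivalence $\Phi\colon\mathbf{D}^{b}(\mathcal{A})\to\mathbf{D}^{b}(\mathcal{E})$. Here "$\phi$ lifts to $\Phi$"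 means that $\Phi$ is a triangle functor such that the composite $\mathbf{K}^*(\mathcal{A})\to\mathbf{D}^*(\mathcal{A})\xrightarrow{\Phi}\mathbf{D}^*(\mathcal{E})$ is isomorphic, compatibly with the shifts, to the composite $\mathbf{K}^*(\mathcal{A})\xrightarrow{\mathbf{K}^*(\phi)}\mathbf{K}^*(\mathcal{E})\to\mathbf{D}^*(\mathcal{E})$, where $\mathbf{K}^*(\phi)$ applies $\phi$ termwise. -/

import Mathlib

open CategoryTheory Limits Pretriangulated ZeroObject

universe v u v' u'

namespace OneSidedExact

section Conflation

variable {C : Type u} [Category.{v} C] [Preadditive C]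

/-- `X --f--> Y --g--> Z` is a kernel-cokernel pair: `f` is a kernel of `g` and `g` is a cokernel
of `f`. -/
def IsKernelCokernelPair (S : ShortComplex C) : Prop :=
  Nonempty (IsLimit (KernelFork.ofι S.f S.zero)) ∧
    Nonempty (IsColimit (CokernelCofork.ofπ S.g S.zero))

end Conflation

/-- A conflation category: an additive category with a class of kernel-cokernel pairs, called
conflations, which is closed under isomorphisms. -/
class ConflationCategory (C : Type u) [Category.{v} C] [Preadditive C] [HasZeroObject C]
    [HasBinaryBiproducts C] where
  /-- the class of conflations -/
  conflation : ObjectProperty (ShortComplex C)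
  isKernelCokernelPair : ∀ S : ShortComplex C, conflation S → IsKernelCokernelPair S
  of_iso : ∀ {S T : ShortComplex C}, (S ≅ T) → conflation S → conflation T

section Basic

variable {C : Type u} [Category.{v} C] [Preadditive C] [HasZeroObject C]
  [HasBinaryBiproducts C] [ConflationCategory C]

/-- The sequence `X --f--> Y --g--> Z` is a conflation. -/
def IsConflation {X Y Z : C} (f : X ⟶ Y) (g : Y ⟶ Z) : Prop :=
  ∃ w : f ≫ g = 0, ConflationCategory.conflation (ShortComplex.mk f g w)

/-- Inflations are the kernel parts of conflations. -/
def IsInflation {X Y : C} (f : X ⟶ Y) : Prop :=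
  ∃ (Z : C) (g : Y ⟶ Z), IsConflation f g

/-- Deflations are the cokernel parts of conflations. -/
def IsDeflation {Y Z : C} (g : Y ⟶ Z) : Prop :=
  ∃ (X : C) (f : X ⟶ Y), IsConflation f g

/-- A cochain complex `X` is acyclic if every differential `d : Xⁱ ⟶ Xⁱ⁺¹` is admissible, i.e.
factors as a deflation `p : Xⁱ ⟶ I` followed by an inflation `j : I ⟶ Xⁱ⁺¹` (so that `I` is the
image of `d`), and this image is the kernel of the next differential. -/
def IsAcyclic (X : CochainComplex C ℤ) : Prop :=
  ∀ i j k : ℤ, i + 1 = j → j + 1 = k →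
    ∃ (I : C) (p : X.X i ⟶ I) (ι : I ⟶ X.X j) (w : ι ≫ X.d j k = 0),
      IsDeflation p ∧ IsInflation ι ∧ p ≫ ι = X.d i j ∧
        Nonempty (IsLimit (KernelFork.ofι ι w))

end Basic

/-- Deflation-exact categories: conflation categories satisfying the axioms `R0`, `R1`, `R2`. -/
class IsDeflationExact (C : Type u) [Category.{v} C] [Preadditive C] [HasZeroObject C]
    [HasBinaryBiproducts C] [ConflationCategory C] : Prop where
  /-- `R0`: every morphism to a zero object is a deflation -/
  deflation_to_zero : ∀ {X Z : C} (f : X ⟶ Z), IsZero Z → IsDeflation f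
  /-- `R1`: deflations compose -/
  deflation_comp : ∀ {X Y Z : C} (f : X ⟶ Y) (g : Y ⟶ Z),
    IsDeflation f → IsDeflation g → IsDeflation (f ≫ g)
  /-- `R2`, first part: pullbacks of deflations exist -/
  exists_pullback : ∀ {Y Z Z' : C} (p : Y ⟶ Z) (g : Z' ⟶ Z), IsDeflation p →
    ∃ (Y' : C) (f : Y' ⟶ Y) (p' : Y' ⟶ Z'), IsPullback f p' p g
  /-- `R2`, second part: deflations are stable under pullbacks -/
  deflation_of_isPullback : ∀ {Y' Y Z' Z : C} {f : Y' ⟶ Y} {p' : Y' ⟶ Z'} {p : Y ⟶ Z}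
    {g : Z' ⟶ Z}, IsPullback f p' p g → IsDeflation p → IsDeflation p'

/-! ### Full additive subcategories and their resolutions -/

section Subcategory

variable {E : Type u} [Category.{v} E] [Preadditive E] [HasZeroObject E] [HasBinaryBiproducts E]

instance hasBinaryBiproducts_fullSubcategory (A : ObjectProperty E)
    [A.IsClosedUnderBinaryProducts] : HasBinaryBiproducts A.FullSubcategory :=
  HasBinaryBiproducts.of_hasBinaryProducts

/-- A full subcategory reflects kernel-cokernel pairs. -/
lemma isKernelCokernelPair_of_map_ι {E : Type u} [Category.{v} E] [Preadditive E]
    (A : ObjectProperty E) (S : ShortComplex A.FullSubcategory)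
    (h : IsKernelCokernelPair (S.map A.ι)) : IsKernelCokernelPair S := by
  obtain ⟨⟨h₁⟩, ⟨h₂⟩⟩ := h
  refine ⟨⟨isLimitOfReflects A.ι ((isLimitMapConeForkEquiv' A.ι S.zero).symm h₁)⟩,
    ⟨isColimitOfReflects A.ι ((isColimitMapCoconeCoforkEquiv' A.ι S.zero).symm h₂)⟩⟩

/-- The conflations that a full additive subcategory inherits: a sequence in `A` is a conflation
of `A` if and only if it is a conflation of `E`. -/
instance inheritedConflations [ConflationCategory E] (A : ObjectProperty E) [A.ContainsZero]
    [A.IsClosedUnderBinaryProducts] : ConflationCategory A.FullSubcategory where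
  conflation S := ConflationCategory.conflation (S.map A.ι)
  isKernelCokernelPair S h :=
    isKernelCokernelPair_of_map_ι A S (ConflationCategory.isKernelCokernelPair _ h)
  of_iso e h := ConflationCategory.of_iso (A.ι.mapShortComplex.mapIso e) h

variable [ConflationCategory E]

/-- The full subcategory `A` is preresolving: every object of `E` admits a deflation from an
object of `A`, and `A` is closed under kernels of deflations. -/
structure IsPreresolving (A : ObjectProperty E) : Prop where
  exists_deflation : ∀ X : E, ∃ (Y : E) (p : Y ⟶ X), A Y ∧ IsDeflation p
  deflation_closed : ∀ {X Y Z : E} (f : X ⟶ Y) (g : Y ⟶ Z), IsConflation f g → A Y → A Z → A X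

/-- There is an exact sequence `0 ⟶ A⁻ⁿ ⟶ ⋯ ⟶ A⁰ ⟶ X ⟶ 0` with all `Aⁱ` in `A`, i.e. an
acyclic complex concentrated in degrees `-n, …, 1`, with `X` in degree `1` and objects of `A` in
the degrees `-n, …, 0`. -/
def HasResolutionOfLength (A : ObjectProperty E) (X : E) (n : ℕ) : Prop :=
  ∃ K : CochainComplex E ℤ, IsAcyclic K ∧ Nonempty (K.X 1 ≅ X) ∧
    (∀ i : ℤ, -(n : ℤ) ≤ i → i ≤ 0 → A (K.X i)) ∧
    (∀ i : ℤ, i < -(n : ℤ) ∨ 1 < i → IsZero (K.X i))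

/-- The `A`-resolution dimension of `X`: the smallest length of a resolution of `X` by objects
of `A`, and `⊤` if there is none of finite length. -/
noncomputable def resDim (A : ObjectProperty E) (X : E) : ℕ∞ :=
  ⨅ (n : ℕ) (_ : HasResolutionOfLength A X n), (n : ℕ∞)

/-- Finitely preresolving subcategories: every object has finite resolution dimension. -/
structure IsFinitelyPreresolving (A : ObjectProperty E) : Prop extends IsPreresolving A where
  resDim_lt_top : ∀ X : E, resDim A X < ⊤

end Subcategory

/-! ### Thick closures -/

section Thick

variable {T : Type u} [Category.{v} T] [HasZeroObject T] [HasShift T ℤ] [Preadditive T]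
  [∀ n : ℤ, (shiftFunctor T n).Additive] [Pretriangulated T]

/-- The thick closure of a class of objects: the smallest triangulated subcategory which contains
it and is closed under direct summands. -/
def thickClosure (P : ObjectProperty T) : ObjectProperty T :=
  fun X => ∀ Q : ObjectProperty T, Q.IsTriangulated → Q.IsStableUnderRetracts → P ≤ Q → Q X

lemma le_thickClosure (P : ObjectProperty T) : P ≤ thickClosure P :=
  fun X hX _ _ _ hQ => hQ X hX

lemma thickClosure_le (P Q : ObjectProperty T) [h₁ : Q.IsTriangulated]
    [h₂ : Q.IsStableUnderRetracts] (h : P ≤ Q) : thickClosure P ≤ Q :=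
  fun _ hX => hX Q h₁ h₂ h

instance (P : ObjectProperty T) : (thickClosure P).IsStableUnderRetracts where
  of_retract r hY Q h₁ h₂ hQ := Q.prop_of_retract r (hY Q h₁ h₂ hQ)

instance (P : ObjectProperty T) : (thickClosure P).IsTriangulated where
  exists_zero := ⟨0, isZero_zero T, fun Q _ _ _ => Q.prop_zero⟩
  isStableUnderShiftBy n := ⟨fun _ hX Q h₁ h₂ hQ => Q.le_shift n _ (hX Q h₁ h₂ hQ)⟩
  ext₂' S hS hX hZ := ObjectProperty.le_isoClosure _ _ (fun Q h₁ h₂ hQ =>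
    Q.ext_of_isTriangulatedClosed₂ S hS (hX Q h₁ h₂ hQ) (hZ Q h₁ h₂ hQ))

end Thick

/-! ### The homotopy categories of bounded above and of bounded complexes -/

section Homotopy

variable (C : Type u) [Category.{v} C] [Preadditive C]

/-- Complexes which vanish in all large degrees. -/
def minus : ObjectProperty (HomotopyCategory C (ComplexShape.up ℤ)) :=
  fun K => ∃ b : ℤ, CochainComplex.IsStrictlyLE (C := C) K.as b

/-- Complexes which vanish in all but finitely many degrees. -/
def bounded : ObjectProperty (HomotopyCategory C (ComplexShape.up ℤ)) :=
  fun K => ∃ a b : ℤ, CochainComplex.IsStrictlyGE (C := C) K.as a ∧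
    CochainComplex.IsStrictlyLE (C := C) K.as b

variable {C} in
lemma minus_quotient_obj_iff (K : CochainComplex C ℤ) :
    minus C ((HomotopyCategory.quotient _ _).obj K) ↔ ∃ b : ℤ, K.IsStrictlyLE b := Iff.rfl

variable {C} in
lemma bounded_quotient_obj_iff (K : CochainComplex C ℤ) :
    bounded C ((HomotopyCategory.quotient _ _).obj K) ↔
      ∃ a b : ℤ, K.IsStrictlyGE a ∧ K.IsStrictlyLE b := Iff.rfl

variable {C} in
lemma isStrictlyLE_mappingCone [HasBinaryBiproducts C] {K L : CochainComplex C ℤ} (f : K ⟶ L)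
    (b₁ b₂ : ℤ) [K.IsStrictlyLE b₁] [L.IsStrictlyLE b₂] :
    (CochainComplex.mappingCone f).IsStrictlyLE (max b₁ b₂) := by
  rw [CochainComplex.isStrictlyLE_iff]
  intro i hi
  simp only [sup_lt_iff] at hi
  simp only [CochainComplex.mappingCone.isZero_X_iff]
  exact ⟨K.isZero_of_isStrictlyLE b₁ _, L.isZero_of_isStrictlyLE b₂ _⟩

instance [HasZeroObject C] : (minus C).ContainsZero where
  exists_zero := ⟨(HomotopyCategory.quotient _ _).obj 0,
    Functor.map_isZero _ (isZero_zero _), 0,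
    inferInstanceAs (CochainComplex.IsStrictlyLE (0 : CochainComplex C ℤ) 0)⟩

instance [HasZeroObject C] : (bounded C).ContainsZero where
  exists_zero := ⟨(HomotopyCategory.quotient _ _).obj 0,
    Functor.map_isZero _ (isZero_zero _), 0, 0,
    inferInstanceAs (CochainComplex.IsStrictlyGE (0 : CochainComplex C ℤ) 0),
    inferInstanceAs (CochainComplex.IsStrictlyLE (0 : CochainComplex C ℤ) 0)⟩

instance : (minus C).IsStableUnderShift ℤ where
  isStableUnderShiftBy n := ⟨by
    rintro K ⟨b, hb⟩
    obtain ⟨K : CochainComplex C ℤ, rfl⟩ := K.quotient_obj_surjective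
    have : K.IsStrictlyLE b := hb
    rw [ObjectProperty.prop_shift_iff, HomotopyCategory.shift_quotient_obj,
      minus_quotient_obj_iff]
    exact ⟨b - n, K.isStrictlyLE_shift b n (b - n) (by lia)⟩⟩

instance : (bounded C).IsStableUnderShift ℤ where
  isStableUnderShiftBy n := ⟨by
    rintro K ⟨a, b, ha, hb⟩
    obtain ⟨K : CochainComplex C ℤ, rfl⟩ := K.quotient_obj_surjective
    have : K.IsStrictlyGE a := ha
    have : K.IsStrictlyLE b := hb
    rw [ObjectProperty.prop_shift_iff, HomotopyCategory.shift_quotient_obj,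
      bounded_quotient_obj_iff]
    exact ⟨a - n, b - n, K.isStrictlyGE_shift a n (a - n) (by lia),
      K.isStrictlyLE_shift b n (b - n) (by lia)⟩⟩

/-- A distinguished triangle is, up to isomorphism, a mapping cone triangle on the same first two
objects. -/
lemma exists_iso_mappingCone [HasZeroObject C] [HasBinaryBiproducts C]
    (T : Triangle (HomotopyCategory C (ComplexShape.up ℤ))) (hT : T ∈ distTriang _) :
    ∃ f : T.obj₁.as ⟶ T.obj₂.as, Nonempty (T.obj₃ ≅
      (HomotopyCategory.quotient C (ComplexShape.up ℤ)).obj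
        (CochainComplex.mappingCone (C := C) f)) := by
  obtain ⟨f : T.obj₁.as ⟶ T.obj₂.as, hf⟩ :=
    (HomotopyCategory.quotient C (ComplexShape.up ℤ)).map_surjective T.mor₁
  exact ⟨f, ⟨Triangle.π₃.mapIso (isoTriangleOfIso₁₂ T _ hT
    (HomotopyCategory.mappingCone_triangleh_distinguished f) (Iso.refl _) (Iso.refl _)
      (by rw [← hf]; exact (Category.comp_id _).trans (Category.id_comp _).symm))⟩⟩

instance [HasZeroObject C] [HasBinaryBiproducts C] : (minus C).IsTriangulatedClosed₃ where
  ext₃' T hT := by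
    rintro ⟨b₁, h₁⟩ ⟨b₂, h₂⟩
    obtain ⟨f, ⟨e⟩⟩ := exists_iso_mappingCone C T hT
    exact ⟨_, ⟨_, isStrictlyLE_mappingCone f b₁ b₂⟩, ⟨e⟩⟩

instance [HasZeroObject C] [HasBinaryBiproducts C] : (bounded C).IsTriangulatedClosed₃ where
  ext₃' T hT := by
    rintro ⟨a₁, b₁, h₁, h₁'⟩ ⟨a₂, b₂, h₂, h₂'⟩
    obtain ⟨f, ⟨e⟩⟩ := exists_iso_mappingCone C T hT
    exact ⟨_, ⟨min (a₁ - 1) a₂, _, CochainComplex.isStrictlyGE_mappingCone f a₁ a₂ _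
      (by simp) (by simp), isStrictlyLE_mappingCone f b₁ b₂⟩, ⟨e⟩⟩

instance [HasZeroObject C] [HasBinaryBiproducts C] : (minus C).IsTriangulated where
  toIsTriangulatedClosed₂ := .of_isTriangulatedClosed₃

instance [HasZeroObject C] [HasBinaryBiproducts C] : (bounded C).IsTriangulated where
  toIsTriangulatedClosed₂ := .of_isTriangulatedClosed₃

/-- The homotopy category `K⁻(C)` of bounded above complexes. -/
abbrev KMinus := (minus C).FullSubcategory

/-- The homotopy category `Kᵇ(C)` of bounded complexes. -/
abbrev KBounded := (bounded C).FullSubcategory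

end Homotopy

/-! ### The derived categories -/

section Derived

variable (C : Type u) [Category.{v} C] [Preadditive C] [HasZeroObject C]
  [HasBinaryBiproducts C] [ConflationCategory C]

/-- The acyclic complexes in `K⁻(C)`. -/
def acyclicMinus : ObjectProperty (KMinus C) := fun K => IsAcyclic (C := C) K.obj.as

/-- The acyclic complexes in `Kᵇ(C)`. -/
def acyclicBounded : ObjectProperty (KBounded C) := fun K => IsAcyclic (C := C) K.obj.as

/-- The derived category `D⁻(C)`: the Verdier quotient of `K⁻(C)` by the thick closure of the
acyclic complexes, i.e. the localization at the morphisms whose cone lies in it. -/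
abbrev DMinus := (thickClosure (acyclicMinus C)).trW.Localization

/-- The derived category `Dᵇ(C)`: the Verdier quotient of `Kᵇ(C)` by the thick closure of the
acyclic complexes, i.e. the localization at the morphisms whose cone lies in it. -/
abbrev DBounded := (thickClosure (acyclicBounded C)).trW.Localization

/-- The quotient functor `K⁻(C) ⥤ D⁻(C)`. -/
abbrev QMinus : KMinus C ⥤ DMinus C := (thickClosure (acyclicMinus C)).trW.Q

/-- The quotient functor `Kᵇ(C) ⥤ Dᵇ(C)`. -/
abbrev QBounded : KBounded C ⥤ DBounded C := (thickClosure (acyclicBounded C)).trW.Q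

end Derived

section Functor

variable {C : Type u} {D : Type u'} [Category.{v} C] [Category.{v'} D] [Preadditive C]
  [Preadditive D] (F : C ⥤ D) [F.Additive]

/-- The functor `K⁻(C) ⥤ K⁻(D)` that applies an additive functor termwise. -/
def mapKMinus : KMinus C ⥤ KMinus D :=
  (minus D).lift ((minus C).ι ⋙ F.mapHomotopyCategory (ComplexShape.up ℤ)) (by
    rintro ⟨X, b, hb⟩
    obtain ⟨K, rfl⟩ := HomotopyCategory.quotient_obj_surjective X
    have : CochainComplex.IsStrictlyLE (C := C) K b := hb
    exact ⟨b, inferInstanceAs (CochainComplex.IsStrictlyLE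
      ((F.mapHomologicalComplex (ComplexShape.up ℤ)).obj K) b)⟩)

/-- The functor `Kᵇ(C) ⥤ Kᵇ(D)` that applies an additive functor termwise. -/
def mapKBounded : KBounded C ⥤ KBounded D :=
  (bounded D).lift ((bounded C).ι ⋙ F.mapHomotopyCategory (ComplexShape.up ℤ)) (by
    rintro ⟨X, a, b, ha, hb⟩
    obtain ⟨K, rfl⟩ := HomotopyCategory.quotient_obj_surjective X
    have : CochainComplex.IsStrictlyGE (C := C) K a := ha
    have : CochainComplex.IsStrictlyLE (C := C) K b := hb
    exact ⟨a, b, inferInstanceAs (CochainComplex.IsStrictlyGE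
        ((F.mapHomologicalComplex (ComplexShape.up ℤ)).obj K) a),
      inferInstanceAs (CochainComplex.IsStrictlyLE
        ((F.mapHomologicalComplex (ComplexShape.up ℤ)).obj K) b)⟩)

noncomputable instance : (mapKMinus F).CommShift ℤ :=
  inferInstanceAs (((minus D).lift ((minus C).ι ⋙
    F.mapHomotopyCategory (ComplexShape.up ℤ)) _).CommShift ℤ)

noncomputable instance : (mapKBounded F).CommShift ℤ :=
  inferInstanceAs (((bounded D).lift ((bounded C).ι ⋙
    F.mapHomotopyCategory (ComplexShape.up ℤ)) _).CommShift ℤ)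

end Functor

end OneSidedExact

open OneSidedExact

namespace OneSidedExact

/-! ### Verdier quotients by the preimage of a triangulated subcategory -/

section Verdier

variable {C : Type u} {D : Type u'} [Category.{v} C] [Category.{v'} D]
  [HasZeroObject C] [HasZeroObject D] [HasShift C ℤ] [HasShift D ℤ] [Preadditive C] [Preadditive D]
  [∀ n : ℤ, (shiftFunctor C n).Additive] [∀ n : ℤ, (shiftFunctor D n).Additive]
  [Pretriangulated C] [Pretriangulated D]

/-! Deflations are stable under composition and pullback, so exactness can be tested locally: a
complex is locally exact (`LocallyExact`) if every cycle becomes a boundary after composition with a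
deflation. Acyclic complexes are locally exact. Acyclicity need not pass to retracts, whereas local
exactness is stable under homotopy retracts, shifts and cones, so it defines a thick subcategory of
the homotopy category.

The main construction (`exists_acyclic_of_isStrictlyLE`, `exists_acyclic_of_isStrictlyGE`) extends a
map from `K` to a locally exact `Y` along a degreewise split inclusion of `K` into an acyclic `L`,
with complements in `A`. Descending from the upper bound of `K`, one covers the cycles in degree `n`
by an object of `A` added in degree `n - 1`; local exactness of `Y` extends the map. Finite
resolutions let the process stop.

For `K = Y` and the identity, `K` becomes a retract of `L`; so the thick closure of the acyclic
complexes consists exactly of the locally exact ones. If `K` has terms in `A`, so does `L`, and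
closure under kernels of deflations makes `L` acyclic in `A`; so the thick closure over `A` is the
inverse image of the one over `E`. For `Y = 0`, the cone `Q` of `K ⟶ L` has terms in `A` up to
homotopy equivalence, and `Q⟦-1⟧ ⟶ K` has acyclic cone `L`. Since the functor between homotopy
categories is fully faithful, Verdier's criterion gives the equivalence
(`exists_equivalence_verdierQuotient`). -/

/-- The localizer morphism given by a triangulated functor `F` when `N₁` is the inverse image
of `N₂` under `F`. -/
def verdierLocalizerMorphism (F : C ⥤ D) [F.CommShift ℤ] [F.IsTriangulated]
    (N₁ : ObjectProperty C) (N₂ : ObjectProperty D) [N₂.IsClosedUnderIsomorphisms]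
    (hN : N₁ = N₂.inverseImage F) : LocalizerMorphism N₁.trW N₂.trW where
  functor := F
  map X Y f hf := by
    subst hN
    exact (N₂.inverseImage_trW_iff F f).1 hf

variable [IsTriangulated D] (F : C ⥤ D) [F.CommShift ℤ] [F.IsTriangulated] [F.Full]
  (N₁ : ObjectProperty C) (N₂ : ObjectProperty D) [N₂.IsClosedUnderIsomorphisms]
  [N₁.IsTriangulated] [N₂.IsTriangulated]

/-- Any resolution `t` of the source of `s` gives the required refinement `t ≫ s`. Since `F` is
full, its essential image is triangulated, so the cone of `t ≫ s` may be taken inside it. -/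
lemma isVerdierLeftLocalizing_essImage
    (h : ∀ Y : D, ∃ (X : C) (s : F.obj X ⟶ Y), N₂.trW s) :
    F.essImage.IsVerdierLeftLocalizing N₂ := by
  rw [ObjectProperty.isVerdierLeftLocalizing_iff]
  intro X Y s hY hs
  obtain ⟨X', t, ht⟩ := h X
  have hts : N₂.trW (t ≫ s) := N₂.trW.comp_mem _ _ ht hs
  refine ⟨_, t ≫ s, t, F.obj_mem_essImage X', ?_, rfl⟩
  have : N₂.trW (F.essImage.ι.map (F.essImage.homMk (X := ⟨_, F.obj_mem_essImage X'⟩)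
    (Y := ⟨Y, hY⟩) (t ≫ s))) := hts
  rw [← ObjectProperty.inverseImage_trW_iff, ObjectProperty.trW_inverseImage_ι_iff] at this
  exact this

variable [F.Faithful]

/-- Factor `F` as an equivalence onto its essential image, which matches the two classes of
morphisms, followed by the inclusion, to which Verdier's criterion applies. -/
lemma isLocalizedFullyFaithful_verdierLocalizerMorphism (hN : N₁ = N₂.inverseImage F)
    (h : ∀ Y : D, ∃ (X : C) (s : F.obj X ⟶ Y), N₂.trW s) :
    (verdierLocalizerMorphism F N₁ N₂ hN).IsLocalizedFullyFaithful := by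
  have := isVerdierLeftLocalizing_essImage F N₂ h
  let Ψ : LocalizerMorphism N₁.trW (N₂.inverseImage F.essImage.ι).trW :=
    { functor := F.toEssImage
      map := by
        subst hN
        intro X Y f hf
        refine (N₂.inverseImage_trW_iff F.essImage.ι _).2 ?_
        exact (N₂.inverseImage_trW_iff F f).1 hf }
  have : Ψ.IsInduced := ⟨by
    subst hN
    ext X Y f
    exact (N₂.inverseImage_trW_iff F.essImage.ι _).trans (N₂.inverseImage_trW_iff F f).symm⟩
  have : Ψ.functor.IsEquivalence := inferInstanceAs (F.toEssImage.IsEquivalence)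
  have := Ψ.isLocalizedEquivalence_of_isInduced
  exact inferInstanceAs
    (Ψ.comp (F.essImage.triangulatedLocalizerMorphism N₂)).IsLocalizedFullyFaithful

end Verdier

/-! ### Triangle equivalences between Verdier quotients -/

section LocalizerMorphism

variable {C : Type u} {D : Type u'} [Category.{v} C] [Category.{v'} D]
  [HasZeroObject C] [HasZeroObject D] [HasShift C ℤ] [HasShift D ℤ] [Preadditive C] [Preadditive D]
  [∀ n : ℤ, (shiftFunctor C n).Additive] [∀ n : ℤ, (shiftFunctor D n).Additive]
  [Pretriangulated C] [Pretriangulated D] [IsTriangulated C] [IsTriangulated D]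
  (N₁ : ObjectProperty C) (N₂ : ObjectProperty D) [N₁.IsTriangulated] [N₂.IsTriangulated]

/-- A localizer morphism of Verdier quotients which is fully faithful on the localized categories
and resolves all objects induces a triangle equivalence. -/
lemma exists_equivalence_of_isLocalizedFullyFaithful (Ψ : LocalizerMorphism N₁.trW N₂.trW)
    [Ψ.functor.CommShift ℤ] [Ψ.functor.IsTriangulated] [Ψ.IsLocalizedFullyFaithful]
    (h : ∀ Y : D, ∃ (X : C) (s : Ψ.functor.obj X ⟶ Y), N₂.trW s) :
    ∃ (Φ : N₁.trW.Localization ⥤ N₂.trW.Localization) (_ : Φ.CommShift ℤ)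
      (e : N₁.trW.Q ⋙ Φ ≅ Ψ.functor ⋙ N₂.trW.Q),
      NatTrans.CommShift e.hom ℤ ∧ Φ.IsTriangulated ∧ Φ.IsEquivalence := by
  let Φ := Ψ.localizedFunctor N₁.trW.Q N₂.trW.Q
  let e : Ψ.functor ⋙ N₂.trW.Q ≅ N₁.trW.Q ⋙ Φ := CatCommSq.iso Ψ.functor N₁.trW.Q N₂.trW.Q Φ
  have he : NatTrans.CommShift e.hom ℤ :=
    inferInstanceAs (NatTrans.CommShift (CatCommSq.iso Ψ.functor N₁.trW.Q N₂.trW.Q Φ).hom ℤ)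
  have he' : NatTrans.CommShift e.symm.hom ℤ := inferInstanceAs (NatTrans.CommShift e.inv ℤ)
  have : N₂.trW.Q.IsTriangulated := Triangulated.Localization.isTriangulated_functor N₂.trW.Q N₂.trW
  have : N₁.trW.Q.IsTriangulated := Triangulated.Localization.isTriangulated_functor N₁.trW.Q N₁.trW
  -- Every arrow of the quotient comes from `C` up to isomorphism, so exactness of `Φ` can be tested
  -- after precomposition with the quotient functor.
  have : N₁.trW.Q.mapArrow.EssSurj := Localization.essSurj_mapArrow N₁.trW.Q N₁.trW
  have : Φ.EssSurj := ⟨fun Z => by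
    have := Localization.essSurj N₂.trW.Q N₂.trW
    obtain ⟨X, s, hs⟩ := h (N₂.trW.Q.objPreimage Z)
    have := Localization.inverts N₂.trW.Q N₂.trW s hs
    exact ⟨N₁.trW.Q.obj X, ⟨e.symm.app X ≪≫ asIso (N₂.trW.Q.map s) ≪≫
      N₂.trW.Q.objObjPreimageIso Z⟩⟩⟩
  exact ⟨Φ, inferInstance, e.symm, he', Functor.isTriangulated_of_precomp_iso e.symm,
    { faithful := inferInstance, full := inferInstance, essSurj := inferInstance }⟩

/-- A fully faithful triangulated functor `F : C ⥤ D` such that every object of `D` is resolved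
by an object of `C` up to `N₂` induces an equivalence of Verdier quotients. -/
theorem exists_equivalence_verdierQuotient [N₂.IsClosedUnderIsomorphisms] (F : C ⥤ D)
    [F.CommShift ℤ] [F.IsTriangulated] [F.Full] [F.Faithful] (hN : N₁ = N₂.inverseImage F)
    (h : ∀ Y : D, ∃ (X : C) (s : F.obj X ⟶ Y), N₂.trW s) :
    ∃ (Φ : N₁.trW.Localization ⥤ N₂.trW.Localization) (_ : Φ.CommShift ℤ)
      (e : N₁.trW.Q ⋙ Φ ≅ F ⋙ N₂.trW.Q),
      NatTrans.CommShift e.hom ℤ ∧ Φ.IsTriangulated ∧ Φ.IsEquivalence := by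
  have := isLocalizedFullyFaithful_verdierLocalizerMorphism F N₁ N₂ hN h
  let : (verdierLocalizerMorphism F N₁ N₂ hN).functor.CommShift ℤ := inferInstanceAs (F.CommShift ℤ)
  have : (verdierLocalizerMorphism F N₁ N₂ hN).functor.IsTriangulated :=
    inferInstanceAs F.IsTriangulated
  exact exists_equivalence_of_isLocalizedFullyFaithful N₁ N₂ (verdierLocalizerMorphism F N₁ N₂ hN) h

end LocalizerMorphism

/-! ### Deflations -/

section Deflations

variable {E : Type u} [Category.{v} E] [Preadditive E] [HasZeroObject E] [HasBinaryBiproducts E]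
  [ConflationCategory E]

lemma IsConflation.zero {X Y Z : E} {f : X ⟶ Y} {g : Y ⟶ Z} (h : IsConflation f g) :
    f ≫ g = 0 := h.choose

lemma IsConflation.nonempty_isLimit {X Y Z : E} {f : X ⟶ Y} {g : Y ⟶ Z} (h : IsConflation f g) :
    Nonempty (IsLimit (KernelFork.ofι f h.zero)) :=
  (ConflationCategory.isKernelCokernelPair _ h.choose_spec).1

lemma IsDeflation.epi {Y Z : E} {g : Y ⟶ Z} (h : IsDeflation g) : Epi g := by
  obtain ⟨X, f, w, hc⟩ := h
  obtain ⟨hl⟩ := (ConflationCategory.isKernelCokernelPair _ hc).2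
  exact ⟨fun a b hab => Cofork.IsColimit.hom_ext hl hab⟩

/-- Any kernel of a deflation forms a conflation with it. -/
lemma IsDeflation.isConflation {X Y Z : E} {f : X ⟶ Y} {g : Y ⟶ Z} (h : IsDeflation g)
    (w : f ≫ g = 0) (hf : IsLimit (KernelFork.ofι f w)) : IsConflation f g := by
  obtain ⟨X', f', w', hc⟩ := h
  obtain ⟨hl⟩ := (ConflationCategory.isKernelCokernelPair _ hc).1
  let e := hl.conePointUniqueUpToIso hf
  have he : e.hom ≫ f = f' := hl.conePointUniqueUpToIso_hom_comp hf WalkingParallelPair.zero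
  exact ⟨w, ConflationCategory.of_iso
    (S := ShortComplex.mk f' g w')
    (ShortComplex.isoMk e (Iso.refl _) (Iso.refl _) (by simpa using he) (by simp)) hc⟩

variable [IsDeflationExact E]

/-- An isomorphism is a pullback of the identity of `0`, a deflation by `R0`. -/
lemma isDeflation_of_isIso {X Y : E} (e : X ⟶ Y) [IsIso e] : IsDeflation e :=
  IsDeflationExact.deflation_of_isPullback (f := (0 : X ⟶ 0)) (p := 𝟙 (0 : E)) (g := 0)
    (IsPullback.of_vert_isIso ⟨by simp⟩)
    (IsDeflationExact.deflation_to_zero _ (isZero_zero E))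

lemma IsDeflation.comp {X Y Z : E} {f : X ⟶ Y} {g : Y ⟶ Z} (hf : IsDeflation f)
    (hg : IsDeflation g) : IsDeflation (f ≫ g) :=
  IsDeflationExact.deflation_comp f g hf hg

/-- Morphisms into the target of a deflation lift to its source after composition with a
deflation. -/
lemma IsDeflation.exists_lift {Y Z T : E} {p : Y ⟶ Z} (hp : IsDeflation p) (u : T ⟶ Z) :
    ∃ (T' : E) (t : T' ⟶ T) (y : T' ⟶ Y), IsDeflation t ∧ y ≫ p = t ≫ u := by
  obtain ⟨T', y, t, h⟩ := IsDeflationExact.exists_pullback p u hp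
  exact ⟨T', t, y, IsDeflationExact.deflation_of_isPullback h hp, h.w⟩

lemma isDeflation_biprod_snd (X Y : E) : IsDeflation (biprod.snd : X ⊞ Y ⟶ Y) :=
  IsDeflationExact.deflation_of_isPullback
    (IsPullback.of_isLimit_binaryFan_of_isTerminal (BinaryBiproduct.isLimit X Y)
      (isZero_zero E).isTerminal)
    (IsDeflationExact.deflation_to_zero _ (isZero_zero E))

/-- This map is the pullback of `p` along the projection `X ⊞ K ⟶ K`. -/
lemma IsDeflation.biprod_map {X P K : E} {p : P ⟶ K} (hp : IsDeflation p) :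
    IsDeflation (biprod.map (𝟙 X) p) := by
  refine IsDeflationExact.deflation_of_isPullback (f := biprod.snd) (p := p) (g := biprod.snd)
    ⟨⟨by simp⟩, ⟨PullbackCone.IsLimit.mk _ (fun s => biprod.lift (s.snd ≫ biprod.fst) s.fst)
      (by simp) ?_ ?_⟩⟩ hp
  · intro s
    have := s.condition
    ext <;> simp [this]
  · intro s m h₁ h₂
    ext
    · simp [← h₂]
    · simp [← h₁]

/-- A morphism from a biproduct is a deflation if its second component is. -/
lemma IsDeflation.biprod_desc {X P K : E} (a : X ⟶ K) {p : P ⟶ K} (hp : IsDeflation p) :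
    IsDeflation (biprod.desc a p) := by
  -- A shear automorphism, which reduces the claim to `biprod.map (𝟙 X) p` followed by a projection.
  let e : X ⊞ K ⟶ X ⊞ K := biprod.lift biprod.fst (biprod.desc a (𝟙 K))
  have : IsIso e := ⟨biprod.lift biprod.fst (biprod.desc (-a) (𝟙 K)),
    by ext <;> simp [e], by ext <;> simp [e]⟩
  have : biprod.desc a p = biprod.map (𝟙 X) p ≫ e ≫ biprod.snd := by
    ext <;> simp [e]
  rw [this]
  exact hp.biprod_map.comp ((isDeflation_of_isIso e).comp (isDeflation_biprod_snd _ _))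

end Deflations

/-! ### Complexes which are acyclic in a given degree, and locally exact complexes -/

section LocallyExact

variable {E : Type u} [Category.{v} E] [Preadditive E]

/-- The object of cycles of the complex `X` in degree `j`, as a kernel of the differential. -/
structure Cycles (X : CochainComplex E ℤ) (j : ℤ) where
  /-- the object of cycles -/
  pt : E
  /-- the inclusion of the cycles -/
  ι : pt ⟶ X.X j
  w : ι ≫ X.d j (j + 1) = 0
  /-- the universal property -/
  isLimit : IsLimit (KernelFork.ofι ι w)

namespace Cycles

variable {X : CochainComplex E ℤ} {j : ℤ} (Z : Cycles X j)

lemma mono_ι : Mono Z.ι := ⟨fun _ _ h => Fork.IsLimit.hom_ext Z.isLimit h⟩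

lemma exists_lift {T : E} (x : T ⟶ X.X j) (hx : x ≫ X.d j (j + 1) = 0) :
    ∃ u : T ⟶ Z.pt, u ≫ Z.ι = x :=
  ⟨_, (KernelFork.IsLimit.lift' Z.isLimit x hx).2⟩

/-- Construction of the object of cycles from a monomorphism. -/
noncomputable def ofMono {K : E} (ι : K ⟶ X.X j) [Mono ι] (w : ι ≫ X.d j (j + 1) = 0)
    (h : ∀ ⦃T : E⦄ (x : T ⟶ X.X j), x ≫ X.d j (j + 1) = 0 → ∃ u : T ⟶ K, u ≫ ι = x) :
    Cycles X j :=
  ⟨K, ι, w, KernelFork.IsLimit.ofι' _ _ fun x hx => ⟨(h x hx).choose, (h x hx).choose_spec⟩⟩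

/-- The cycles of a complex only depend on two consecutive objects. -/
noncomputable def map {Y : CochainComplex E ℤ} (f : X ⟶ Y) [IsIso (f.f j)] [IsIso (f.f (j + 1))] :
    Cycles Y j :=
  have := Z.mono_ι
  have : Mono (Z.ι ≫ f.f j) := mono_comp _ _
  ofMono (Z.ι ≫ f.f j) (by simp [reassoc_of% Z.w]) fun T x hx => by
    obtain ⟨u, hu⟩ := Z.exists_lift (x ≫ inv (f.f j)) (by
      rw [← cancel_mono (f.f (j + 1)), Category.assoc, Category.assoc, ← f.comm,
        IsIso.inv_hom_id_assoc, hx, zero_comp])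
    exact ⟨u, by simp [reassoc_of% hu]⟩

@[simp]
lemma map_pt {Y : CochainComplex E ℤ} (f : X ⟶ Y) [IsIso (f.f j)] [IsIso (f.f (j + 1))] :
    (Z.map f).pt = Z.pt := rfl

@[simp]
lemma map_ι {Y : CochainComplex E ℤ} (f : X ⟶ Y) [IsIso (f.f j)] [IsIso (f.f (j + 1))] :
    (Z.map f).ι = Z.ι ≫ f.f j := rfl

end Cycles

variable [HasZeroObject E] [HasBinaryBiproducts E] [ConflationCategory E]

/-- A complex `X` is acyclic in degree `j` if the differential arriving in this degree is a
deflation onto the cycles. -/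
def AcyclicAt (X : CochainComplex E ℤ) (j : ℤ) : Prop :=
  ∃ Z : Cycles X j, ∀ i, i + 1 = j → ∃ p : X.X i ⟶ Z.pt, IsDeflation p ∧ p ≫ Z.ι = X.d i j

/-- A complex is locally exact if every cycle lifts, after composition with a deflation, along
the differential. -/
def LocallyExact (X : CochainComplex E ℤ) : Prop :=
  ∀ (i j k : ℤ), i + 1 = j → j + 1 = k → ∀ ⦃T : E⦄ (x : T ⟶ X.X j), x ≫ X.d j k = 0 →
    ∃ (T' : E) (t : T' ⟶ T) (y : T' ⟶ X.X i), IsDeflation t ∧ y ≫ X.d i j = t ≫ x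

variable {X Y : CochainComplex E ℤ}

lemma IsDeflation.exists_cycles {j k : ℤ} (hk : j + 1 = k) (Z : Cycles X k) {p : X.X j ⟶ Z.pt}
    (h : IsDeflation p) (hp : p ≫ Z.ι = X.d j k) :
    ∃ Z' : Cycles X j, IsConflation Z'.ι p := by
  subst hk
  obtain ⟨K, f, hc⟩ := h
  obtain ⟨hl⟩ := hc.nonempty_isLimit
  have := Z.mono_ι
  have : Mono f := ⟨fun _ _ h => Fork.IsLimit.hom_ext hl h⟩
  refine ⟨.ofMono f (by rw [← hp, reassoc_of% hc.zero, zero_comp]) fun T x hx =>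
    ⟨_, (KernelFork.IsLimit.lift' hl x ?_).2⟩, hc⟩
  rw [← cancel_mono Z.ι, Category.assoc, hp, hx, zero_comp]

/-- Kernels need not exist in `E`, but those of deflations do: the cycles in degree `j` are the
kernel of the deflation onto the cycles in degree `j + 1`. This is why complexes are made acyclic
from the top downwards. -/
lemma AcyclicAt.exists_cycles {j k : ℤ} (hk : j + 1 = k) (h : AcyclicAt X k) :
    Nonempty (Cycles X j) := by
  obtain ⟨Z, hZ⟩ := h
  obtain ⟨p, hp, fac⟩ := hZ j hk
  exact ⟨(hp.exists_cycles hk Z fac).choose⟩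

lemma Cycles.isConflation {j k : ℤ} (hk : j + 1 = k) (Z : Cycles X j) (Z' : Cycles X k)
    {p : X.X j ⟶ Z'.pt} (h : IsDeflation p) (hp : p ≫ Z'.ι = X.d j k) : IsConflation Z.ι p := by
  subst hk
  have := Z'.mono_ι
  have := Z.mono_ι
  refine h.isConflation (by rw [← cancel_mono Z'.ι, Category.assoc, hp, Z.w, zero_comp])
    (KernelFork.IsLimit.ofι' _ _ fun x hx => ?_)
  have := Z.exists_lift x (by rw [← hp, reassoc_of% hx, zero_comp])
  exact ⟨this.choose, this.choose_spec⟩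

/-- Acyclicity in degree `j` only depends on the degrees `j - 1`, `j` and `j + 1`. -/
lemma AcyclicAt.of_isIso [IsDeflationExact E] {j : ℤ} (h : AcyclicAt X j) (f : X ⟶ Y)
    (hf : ∀ i, j - 1 ≤ i → IsIso (f.f i)) : AcyclicAt Y j := by
  obtain ⟨Z, hZ⟩ := h
  have := hf j (by lia)
  have := hf (j + 1) (by lia)
  refine ⟨Z.map f, fun i hi => ?_⟩
  obtain ⟨p, hd, hp⟩ := hZ i hi
  have := hf i (by lia)
  refine ⟨inv (f.f i) ≫ p, (isDeflation_of_isIso _).comp hd, ?_⟩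
  simp [reassoc_of% hp]

lemma AcyclicAt.of_isZero [IsDeflationExact E] {j : ℤ} (h : IsZero (X.X j)) : AcyclicAt X j :=
  ⟨.ofMono (𝟙 (X.X j)) (h.eq_of_src _ _) fun _ x _ => ⟨x, by simp⟩, fun _ _ =>
    ⟨0, IsDeflationExact.deflation_to_zero _ h, h.eq_of_tgt _ _⟩⟩

/-- A complex is acyclic if and only if it is acyclic in every degree. -/
lemma isAcyclic_iff : IsAcyclic X ↔ ∀ j, AcyclicAt X j := by
  constructor
  · intro h j
    obtain ⟨I, p, ι, w, hp, -, fac, ⟨hl⟩⟩ := h (j - 1) j (j + 1) (by lia) rfl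
    refine ⟨⟨I, ι, w, hl⟩, fun i hi => ?_⟩
    obtain rfl : i = j - 1 := by lia
    exact ⟨p, hp, fac⟩
  · rintro h i j k hi rfl
    obtain ⟨Z, hZ⟩ := h j
    obtain ⟨p, hp, fac⟩ := hZ i hi
    -- The next degree supplies the inflation condition: `Z.ι` is the kernel of the deflation onto
    -- `Z'`.
    obtain ⟨Z', hZ'⟩ := h (j + 1)
    obtain ⟨p', hp', fac'⟩ := hZ' j rfl
    exact ⟨Z.pt, p, Z.ι, Z.w, hp, ⟨_, p', Z.isConflation rfl Z' hp' fac'⟩, fac, ⟨Z.isLimit⟩⟩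

lemma IsAcyclic.locallyExact [IsDeflationExact E] (h : IsAcyclic X) : LocallyExact X := by
  intro i j k hi hj T x hx
  obtain ⟨I, p, ι, w, hp, -, fac, ⟨hl⟩⟩ := h i j k hi hj
  obtain ⟨u, hu⟩ := KernelFork.IsLimit.lift' hl x hx
  obtain ⟨T', t, y, ht, hy⟩ := hp.exists_lift u
  refine ⟨T', t, y, ht, ?_⟩
  rw [← fac, reassoc_of% hy]
  exact congr_arg (t ≫ ·) hu

lemma locallyExact_of_isZero [IsDeflationExact E] (h : ∀ i, IsZero (X.X i)) : LocallyExact X :=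
  fun _ _ _ _ _ T _ _ => ⟨T, 𝟙 T, 0, isDeflation_of_isIso _, (h _).eq_of_tgt _ _⟩

end LocallyExact

/-! ### Attaching a cell to a complex -/

section Attach

open CochainComplex HomComplex

variable {E : Type u} [Category.{v} E] [Preadditive E] [HasZeroObject E] [HasBinaryBiproducts E]

/-- The mapping cone of `φ : K ⟶ L` in degree `m` is the biproduct of `L.X m` and `K.X n`. -/
noncomputable def mappingConeXIsoBiprod {K L : CochainComplex E ℤ} (φ : K ⟶ L) (m n : ℤ)
    (h : m + 1 = n) : (mappingCone φ).X m ≅ L.X m ⊞ K.X n where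
  hom := biprod.lift ((mappingCone.snd φ).v m m (add_zero m)) ((mappingCone.fst φ).1.v m n h)
  inv := biprod.desc ((mappingCone.inr φ).f m) ((mappingCone.inl φ).v n m (by lia))
  hom_inv_id := by
    simp [mappingCone.ext_from_iff _ n m h]
  inv_hom_id := by
    ext <;> simp

/-- Given a cycle `a : B ⟶ K.X n`, there is a complex obtained from `K` by adding the summand `B` in
degree `n - 1`, with differential induced by `a`. -/
lemma exists_attach (K : CochainComplex E ℤ) {m n k : ℤ} (hm : m + 1 = n) (hk : n + 1 = k) {B : E}
    (a : B ⟶ K.X n) (ha : a ≫ K.d n k = 0) :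
    ∃ (L : CochainComplex E ℤ) (f : K ⟶ L) (e : L.X m ≅ K.X m ⊞ B),
      (∀ i, i ≠ m → IsIso (f.f i)) ∧ f.f m ≫ e.hom = biprod.inl ∧
      biprod.inr ≫ e.inv ≫ L.d m n = a ≫ f.f n ∧
      ∀ (Y : CochainComplex E ℤ) (r : K ⟶ Y) (h : B ⟶ Y.X m), h ≫ Y.d m n = a ≫ r.f n →
        ∃ r' : L ⟶ Y, f ≫ r' = r := by
  subst hk
  -- `L` is the cone of the map to `K` from `B` placed in degree `n`; the cone moves `B` to degree
  -- `m = n - 1`.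
  let z : Cocycle ((singleFunctor E n).obj B) K 0 :=
    Cocycle.fromSingleMk a (add_zero n) (n + 1) rfl ha
  let φ := Cocycle.homOf z
  have hφ : φ.f n = (HomologicalComplex.singleObjXSelf (.up ℤ) n B).hom ≫ a := by
    have := Cochain.fromSingleMk_v (K := K) a (add_zero n)
    simpa [φ, z] using this
  let s : ((singleFunctor E n).obj B).X n ≅ B := HomologicalComplex.singleObjXSelf (.up ℤ) n B
  refine ⟨mappingCone φ, mappingCone.inr φ,
    mappingConeXIsoBiprod φ m n hm ≪≫ biprod.mapIso (Iso.refl _) s, ?_, ?_, ?_, ?_⟩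
  · intro i hi
    have h0 : IsZero (((singleFunctor E n).obj B).X (i + 1)) :=
      HomologicalComplex.isZero_single_obj_X _ _ _ _ (by lia)
    refine ⟨(mappingCone.snd φ).v i i (add_zero i), by simp, ?_⟩
    rw [mappingCone.ext_from_iff _ (i + 1) i rfl]
    exact ⟨h0.eq_of_src _ _, by simp⟩
  · ext <;> simp [mappingConeXIsoBiprod]
  · simp [mappingConeXIsoBiprod, mappingCone.inl_v_d φ n m (n + 1) (by lia) (by lia)]
    have hs : s.inv ≫ φ.f n = a := by
      rw [hφ]
      exact s.inv_hom_id_assoc a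
    rw [reassoc_of% hs]
  · intro Y r h hh
    -- A map out of the cone is a map out of `K` with a nullhomotopy of its composite with `φ`; here
    -- `h` is the nullhomotopy.
    refine ⟨mappingCone.desc φ (Cochain.fromSingleMk h (by lia)) r ?_, mappingCone.inr_desc _ _ _ _⟩
    rw [Cochain.δ_fromSingleMk _ _ _ n (by lia)]
    rw [Cochain.ofHom_comp, Cocycle.cochain_ofHom_homOf_eq_coe]
    simp only [hh, Cochain.fromSingleMk_postcomp]
    rfl

end Attach

/-! ### Embeddings into acyclic complexes -/

section

variable {E : Type u} [Category.{v} E] [Preadditive E]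

lemma isIso_over_comp_f {Y : CochainComplex E ℤ} {K L M : Over Y} (f : K ⟶ L) (g : L ⟶ M) (i : ℤ)
    (hf : IsIso (f.left.f i)) (hg : IsIso (g.left.f i)) : IsIso ((f ≫ g).left.f i) := by
  rw [Over.comp_left, HomologicalComplex.comp_f]
  infer_instance

end

/-! ### Degreewise split inclusions and the successive attachment of cells -/

section Resolution

variable {E : Type u} [Category.{v} E] [Preadditive E] [HasBinaryBiproducts E]

/-- The morphism of complexes `f` is in each degree the inclusion of a direct summand with a
complement in `A`. -/
def IsSplitWithComplement (A : ObjectProperty E) {K L : CochainComplex E ℤ} (f : K ⟶ L) : Prop :=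
  ∀ i, ∃ (Q : E) (e : L.X i ≅ K.X i ⊞ Q), A Q ∧ f.f i ≫ e.hom = biprod.inl

namespace IsSplitWithComplement

variable {A : ObjectProperty E} {K L M : CochainComplex E ℤ}

lemma exists_of_isIso [A.ContainsZero] {X Y : E} (f : X ⟶ Y) [IsIso f] :
    ∃ (Q : E) (e : Y ≅ X ⊞ Q), A Q ∧ f ≫ e.hom = biprod.inl := by
  obtain ⟨Q, h0, hQ⟩ := A.exists_prop_of_containsZero
  exact ⟨Q, (asIso f).symm ≪≫
    ⟨biprod.inl, biprod.fst, by simp, by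
      ext <;> first | exact h0.eq_of_src _ _ | simp⟩, hQ, by simp⟩

lemma comp [A.IsClosedUnderBinaryProducts] {f : K ⟶ L} {g : L ⟶ M}
    (hf : IsSplitWithComplement A f) (hg : IsSplitWithComplement A g) :
    IsSplitWithComplement A (f ≫ g) := fun i => by
  obtain ⟨Q, e, hQ, h⟩ := hf i
  obtain ⟨Q', e', hQ', h'⟩ := hg i
  refine ⟨Q ⊞ Q', e' ≪≫ biprod.mapIso e (Iso.refl _) ≪≫ biprod.associator _ _ _, ?_, ?_⟩
  · exact A.prop_of_isLimit (BinaryBiproduct.isLimit Q Q') (by rintro ⟨_ | _⟩ <;> assumption)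
  · simp [reassoc_of% h']
    simp only [reassoc_of% h]
    ext <;> simp

lemma prop_X [A.IsClosedUnderBinaryProducts] {f : K ⟶ L}
    (hf : IsSplitWithComplement A f) (i : ℤ) (hi : A (K.X i)) : A (L.X i) := by
  obtain ⟨Q, e, hQ, -⟩ := hf i
  exact A.prop_of_isLimit ((BinaryBiproduct.isLimit (K.X i) Q).ofIsoLimit
    (BinaryFan.ext (c' := BinaryFan.mk (e.hom ≫ biprod.fst) (e.hom ≫ biprod.snd)) e.symm
      (by simp) (by simp)))
    (by rintro ⟨_ | _⟩ <;> assumption)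

end IsSplitWithComplement

lemma isSplitWithComplement_of_iso_biprod {A : ObjectProperty E} [A.ContainsZero] {K L : CochainComplex E ℤ} (f : K ⟶ L) {m : ℤ} {B : E}
    (hB : A B) (e : L.X m ≅ K.X m ⊞ B) (hf : ∀ i, i ≠ m → IsIso (f.f i))
    (he : f.f m ≫ e.hom = biprod.inl) : IsSplitWithComplement A f := by
  intro i
  by_cases hi : i = m
  · subst hi
    exact ⟨B, e, hB, he⟩
  · have := hf i hi
    exact IsSplitWithComplement.exists_of_isIso _

variable [HasZeroObject E] [ConflationCategory E] [IsDeflationExact E]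

/-- Attaching a cell along a deflation `p : B ⟶ Z` onto the cycles in degree `n` makes the complex
acyclic in this degree. -/
lemma exists_attach_acyclicAt (K : CochainComplex E ℤ) {m n : ℤ} (hm : m + 1 = n)
    (Z : Cycles K n) {B : E} (p : B ⟶ Z.pt) (hp : IsDeflation p) :
    ∃ (L : CochainComplex E ℤ) (f : K ⟶ L) (e : L.X m ≅ K.X m ⊞ B),
      (∀ i, i ≠ m → IsIso (f.f i)) ∧ f.f m ≫ e.hom = biprod.inl ∧
      AcyclicAt L n ∧
      (IsZero (K.X m) → ∀ (W : E) (k : W ⟶ B), IsConflation k p →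
        ∃ Z' : Cycles L m, Z'.pt = W) ∧
      ∀ (Y : CochainComplex E ℤ) (r : K ⟶ Y) (h : B ⟶ Y.X m), h ≫ Y.d m n = p ≫ Z.ι ≫ r.f n →
        ∃ r' : L ⟶ Y, f ≫ r' = r := by
  obtain ⟨L, f, e, hf, he, hd, hr⟩ := exists_attach K hm rfl (p ≫ Z.ι) (by simp [Z.w])
  have := hf n (by lia)
  have := hf (n + 1) (by lia)
  have := Z.mono_ι
  obtain ⟨q, hq⟩ := Z.exists_lift (K.d m n) (by simp)
  have he' : biprod.inl ≫ e.inv = f.f m := by rw [← he]; simp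
  -- The new differential factors through the old cycles by `biprod.desc q p`, which is a deflation
  -- because `p` is.
  have hd' : e.inv ≫ L.d m n = biprod.desc q p ≫ Z.ι ≫ f.f n := by
    ext
    · rw [reassoc_of% he', biprod.inl_desc_assoc, reassoc_of% hq, f.comm]
    · rw [hd, biprod.inr_desc_assoc, Category.assoc]
  have hac : AcyclicAt L n := by
    refine ⟨Z.map f, fun i hi => ?_⟩
    obtain rfl : i = m := by lia
    refine ⟨e.hom ≫ biprod.desc q p, (isDeflation_of_isIso _).comp (hp.biprod_desc q), ?_⟩
    have : (e.hom ≫ biprod.desc q p) ≫ Z.ι ≫ f.f n = L.d i n := by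
      rw [Category.assoc, ← hd', e.hom_inv_id_assoc]
    exact this
  refine ⟨L, f, e, hf, he, hac, fun h0 W k hk => ?_, by simpa using hr⟩
  subst hm
  have : Mono k := by
    obtain ⟨hl⟩ := hk.nonempty_isLimit
    exact ⟨fun _ _ h => Fork.IsLimit.hom_ext hl h⟩
  have : Mono (k ≫ biprod.inr ≫ e.inv) := inferInstance
  -- When `K.X m` vanishes, `L.X m` is just `B`, so the cycles in degree `m` are the kernel of `p`.
  refine ⟨.ofMono (k ≫ biprod.inr ≫ e.inv) ?_ fun T x hx => ?_, rfl⟩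
  · simp [hd', reassoc_of% hk.zero]
  · obtain ⟨hl⟩ := hk.nonempty_isLimit
    have hx' : x ≫ e.hom = (x ≫ e.hom ≫ biprod.snd) ≫ biprod.inr := by
      ext
      · exact h0.eq_of_tgt _ _
      · simp
    obtain ⟨u, hu⟩ := KernelFork.IsLimit.lift' hl (x ≫ e.hom ≫ biprod.snd) (by
      have : x ≫ e.hom ≫ e.inv ≫ L.d m (m + 1) = 0 := by simpa using hx
      rw [hd', reassoc_of% hx'] at this
      rw [← cancel_mono (Z.ι ≫ f.f (m + 1)), zero_comp]
      simpa using this)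
    refine ⟨u, ?_⟩
    have hu : u ≫ k = _ := hu
    rw [reassoc_of% hu, ← cancel_mono e.hom, hx']
    simp

variable {A : ObjectProperty E} [A.ContainsZero]

/-- A complex `K` over a locally exact complex `Y` can be made acyclic in a degree `n` by adding
a summand in degree `n - 1`. -/
lemma exists_step (hA : ∀ X : E, ∃ (B : E) (p : B ⟶ X), A B ∧ IsDeflation p)
    {Y : CochainComplex E ℤ} (hY : LocallyExact Y) (K : Over Y) {m n : ℤ} (hm : m + 1 = n)
    (hK : ∀ j, n < j → AcyclicAt K.left j) :
    ∃ (L : Over Y) (f : K ⟶ L), (∀ j, m < j → AcyclicAt L.left j) ∧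
      IsSplitWithComplement A f.left ∧ ∀ i, i ≠ m → IsIso (f.left.f i) := by
  obtain ⟨Z⟩ := (hK (n + 1) (by lia)).exists_cycles rfl
  -- The cycle of `Y` induced by `Z` becomes a boundary on `T`; covering `T` by an object of `A`
  -- yields a cell which both covers `Z` and maps compatibly to `Y`.
  obtain ⟨T, t, y, ht, hy⟩ := hY m n (n + 1) hm rfl (Z.ι ≫ K.hom.f n) (by simp [reassoc_of% Z.w])
  obtain ⟨B, s, hB, hs⟩ := hA T
  obtain ⟨L, f, e, hf, he, hac, -, hr⟩ := exists_attach_acyclicAt K.left hm Z (s ≫ t) (hs.comp ht)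
  obtain ⟨r, hr⟩ := hr Y K.hom (s ≫ y) (by simp [hy])
  refine ⟨Over.mk r, Over.homMk f hr, fun j hj => ?_,
    isSplitWithComplement_of_iso_biprod f hB e hf he, hf⟩
  obtain rfl | hj := eq_or_ne j n
  · exact hac
  · exact (hK j (by lia)).of_isIso f fun i hi => hf i (by lia)

lemma exists_sequence {D : Type u'} [Category.{v'} D] (P : ℕ → D → Prop)
    (Q : ℕ → ∀ {X Y : D}, (X ⟶ Y) → Prop) (X₀ : D) (h₀ : P 0 X₀)
    (h : ∀ (k : ℕ) (X : D), P k X → ∃ (Y : D) (f : X ⟶ Y), P (k + 1) Y ∧ Q k f) :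
    ∃ (X : ℕ → D) (f : ∀ k, X k ⟶ X (k + 1)), X 0 = X₀ ∧ (∀ k, P k (X k)) ∧ ∀ k, Q k (f k) := by
  choose Y f hY hf using h
  let X : ∀ k, { X : D // P k X } := Nat.rec ⟨X₀, h₀⟩ fun k X => ⟨Y k X.1 X.2, hY k X.1 X.2⟩
  exact ⟨fun k => (X k).1, fun k => f k (X k).1 (X k).2, rfl, fun k => (X k).2, fun k => hf k _ _⟩

/-- The successive resolutions of a bounded above complex over a locally exact complex. -/
lemma exists_resolution_sequence [A.IsClosedUnderBinaryProducts]
    (hA : ∀ X : E, ∃ (B : E) (p : B ⟶ X), A B ∧ IsDeflation p)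
    {Y : CochainComplex E ℤ} (hY : LocallyExact Y) (K : Over Y) (b : ℤ)
    [K.left.IsStrictlyLE b] :
    ∃ (F : ℕ ⥤ Over Y), F.obj 0 = K ∧ (∀ (k : ℕ) (j : ℤ), b - k < j → AcyclicAt (F.obj k).left j) ∧
      ∀ (k l : ℕ) (f : k ⟶ l), IsSplitWithComplement A (F.map f).left ∧
        ∀ i : ℤ, b - k ≤ i ∨ i < b - l → IsIso ((F.map f).left.f i) := by
  obtain ⟨X, f, h₀, hX, hf⟩ := exists_sequence
    (fun k (L : Over Y) => ∀ j : ℤ, b - k < j → AcyclicAt L.left j)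
    (fun k (K L : Over Y) (f : K ⟶ L) => IsSplitWithComplement A f.left ∧ ∀ i : ℤ, i ≠ b - k - 1 → IsIso (f.left.f i)) K
    (fun j hj => .of_isZero (K.left.isZero_of_isStrictlyLE b j (by simpa using hj)))
    -- Stage `k + 1` adds a cell in degree `b - k - 1`; hence from stage `k` to stage `l` only the
    -- degrees `i` with `b - l ≤ i < b - k` change.
    (fun k K hK => by
      obtain ⟨L, f, h₁, h₂⟩ := exists_step hA hY K (m := b - k - 1) (n := b - k) (by lia) hK
      exact ⟨L, f, fun j hj => h₁ j (by push_cast at hj; lia), h₂⟩)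
  refine ⟨Functor.ofSequence f, h₀, hX, fun k l g => ?_⟩
  obtain ⟨d, rfl⟩ := Nat.exists_eq_add_of_le (leOfHom g)
  obtain rfl := Subsingleton.elim (homOfLE (Nat.le_add_right k d)) g
  induction d with
  | zero =>
    rw [show homOfLE (Nat.le_add_right k 0) = 𝟙 k from rfl, CategoryTheory.Functor.map_id]
    have : ∀ i, IsIso ((𝟙 ((Functor.ofSequence f).obj k) :
        (Functor.ofSequence f).obj k ⟶ _).left.f i) := fun i => by
      rw [Over.id_left, HomologicalComplex.id_f]
      infer_instance
    exact ⟨fun i => IsSplitWithComplement.exists_of_isIso _, fun i _ => this i⟩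
  | succ d hd =>
    have h : homOfLE (Nat.le_add_right k (d + 1)) =
      homOfLE (Nat.le_add_right k d) ≫ homOfLE (Nat.le_add_right (k + d) 1) := rfl
    rw [h, Functor.map_comp, Functor.ofSequence_map_homOfLE_succ]
    refine ⟨hd.1.comp (hf (k + d)).1, fun i hi => ?_⟩
    refine isIso_over_comp_f _ _ i (hd.2 i ?_) ((hf (k + d)).2 i ?_)
    all_goals push_cast at hi ⊢; lia

end Resolution

/-! ### Colimits of degreewise eventually constant sequences -/

section Colimit

variable {E : Type u} [Category.{v} E] [Preadditive E]

/-- The colimit of a sequence of complexes over `Y` which is eventually constant in each degree. -/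
lemma exists_colimit {Y : CochainComplex E ℤ} (F : ℕ ⥤ Over Y) (N : ℤ → ℕ)
    (hF : ∀ (k l : ℕ) (f : k ⟶ l) (i : ℤ), N i ≤ k → IsIso ((F.map f).left.f i)) :
    ∃ (L : Over Y) (f : ∀ k, F.obj k ⟶ L), (∀ k (g : 0 ⟶ k), F.map g ≫ f k = f 0) ∧
      ∀ i k, N i ≤ k → IsIso ((f k).left.f i) := by
  let G : ℕ ⥤ CochainComplex E ℤ := F ⋙ Over.forget Y
  have hG : ∀ i, (G ⋙ HomologicalComplex.eval _ _ i).IsEventuallyConstantFrom (N i) :=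
    fun i j f => hF _ _ f i le_rfl
  have : ∀ i, HasColimit (G ⋙ HomologicalComplex.eval _ _ i) := fun i => (hG i).hasColimit
  let c : Cocone G := ⟨Y, ⟨fun k => (F.obj k).hom, fun k l f => by simp [G]⟩⟩
  refine ⟨Over.mk (colimit.desc G c), fun k => Over.homMk (colimit.ι G k) (colimit.ι_desc c k),
    fun k g => ?_, fun i k hk => ?_⟩
  · ext1
    exact colimit.w G g
  · have := (hG i).postcomp (homOfLE hk)
    exact this.isIso_ι_of_isColimit
      (isColimitOfPreserves (HomologicalComplex.eval _ _ i) (colimit.isColimit G))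

end Colimit

/-! ### Acyclic extensions of bounded above and of bounded complexes -/

section Main

variable {E : Type u} [Category.{v} E] [Preadditive E] [HasZeroObject E] [HasBinaryBiproducts E]
  [ConflationCategory E] [IsDeflationExact E] {A : ObjectProperty E} [A.ContainsZero]
  [A.IsClosedUnderBinaryProducts]

/-- A bounded above complex over a locally exact complex `Y` embeds over `Y` into an acyclic bounded
above complex, with a degreewise complement in `A`. -/
theorem exists_acyclic_of_isStrictlyLE (hA : ∀ X : E, ∃ (B : E) (p : B ⟶ X), A B ∧ IsDeflation p)
    {K Y : CochainComplex E ℤ} (hY : LocallyExact Y) (r : K ⟶ Y) (b : ℤ) [K.IsStrictlyLE b] :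
    ∃ (L : CochainComplex E ℤ) (f : K ⟶ L) (r' : L ⟶ Y), f ≫ r' = r ∧ IsAcyclic L ∧
      L.IsStrictlyLE b ∧ IsSplitWithComplement A f := by
  suffices h : ∀ K : Over Y, K.left.IsStrictlyLE b → ∃ (L : Over Y) (f : K ⟶ L),
      IsAcyclic L.left ∧ L.left.IsStrictlyLE b ∧ IsSplitWithComplement A f.left by
    obtain ⟨L, f, h₁, h₂, h₃⟩ := h (Over.mk r) (inferInstanceAs (K.IsStrictlyLE b))
    exact ⟨L.left, f.left, L.hom, Over.w f, h₁, h₂, h₃⟩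
  intro K hK
  obtain ⟨F, rfl, hF, hF'⟩ := exists_resolution_sequence hA hY K b
  obtain ⟨L, f, hf, hf'⟩ := exists_colimit F (fun i => (b - i).toNat)
    (fun k l f i hk => (hF' k l f).2 i (Or.inl (by lia)))
  refine ⟨L, f 0, isAcyclic_iff.2 fun j => ?_, ?_, fun i => ?_⟩
  -- Stage `b - j + 1` is acyclic in degree `j` and already agrees with the colimit in all degrees
  -- from `j - 1` on.
  · exact (hF (b - j + 1).toNat j (by lia)).of_isIso (f _).left fun i hi => hf' i _ (by lia)
  · rw [CochainComplex.isStrictlyLE_iff]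
    intro i hi
    have := hf' i 0 (by lia)
    exact IsZero.of_iso ((F.obj 0).left.isZero_of_isStrictlyLE b i)
      (asIso ((f 0).left.f i)).symm
  · have := hf' i (b - i).toNat le_rfl
    obtain ⟨Q, e, hQ, he⟩ := (hF' 0 (b - i).toNat (homOfLE (by lia))).1 i
    refine ⟨Q, (asIso ((f (b - i).toNat).left.f i)).symm ≪≫ e, hQ, ?_⟩
    rw [← hf (b - i).toNat (homOfLE (Nat.zero_le _)), Over.comp_left, HomologicalComplex.comp_f]
    simpa using he

/-- The objects with a finite resolution by objects in `A`. -/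
inductive HasFiniteResolution (A : ObjectProperty E) : E → Prop
  | of_isZero {X : E} (h : IsZero X) : HasFiniteResolution A X
  | of_isConflation {K B X : E} (i : K ⟶ B) (p : B ⟶ X) (h : IsConflation i p) (hB : A B)
      (hK : HasFiniteResolution A K) : HasFiniteResolution A X

/-- Induction on the finite resolution of the lowest cycles `Z`. If they vanish, `K` is already
acyclic. Otherwise attach the first term `B` of the resolution in degree `n - 1`, where `K` is zero:
the new lowest cycles are the kernel `W`, whose resolution is one step shorter. -/
lemma exists_acyclic_of_hasFiniteResolution {Y : CochainComplex E ℤ} (hY : LocallyExact Y) (a : ℤ)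
    [Y.IsStrictlyGE a] {X : E} (hX : HasFiniteResolution A X) :
    ∀ (K : CochainComplex E ℤ) (r : K ⟶ Y) (n : ℤ) (_ : n ≤ a) (_ : K.IsStrictlyGE n)
      (_ : ∀ j, n < j → AcyclicAt K j) (Z : Cycles K n) (_ : Z.pt = X),
      ∃ (L : CochainComplex E ℤ) (f : K ⟶ L) (r' : L ⟶ Y), f ≫ r' = r ∧ IsAcyclic L ∧
        (∃ c, L.IsStrictlyGE c) ∧ IsSplitWithComplement A f ∧
        ∀ i, n ≤ i → IsIso (f.f i) := by
  induction hX with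
  | of_isZero h =>
    rintro K r n hn hK hK' Z rfl
    refine ⟨K, 𝟙 K, r, by simp, isAcyclic_iff.2 fun j => ?_, ⟨n, hK⟩,
      fun i => IsSplitWithComplement.exists_of_isIso _, fun i _ => inferInstance⟩
    obtain hj | rfl | hj := lt_trichotomy j n
    · exact .of_isZero (K.isZero_of_isStrictlyGE n j)
    · exact ⟨Z, fun i hi => ⟨0, IsDeflationExact.deflation_to_zero _ h,
        (K.isZero_of_isStrictlyGE j i).eq_of_src _ _⟩⟩
    · exact hK' j hj
  | @of_isConflation W B X k p h hB _ ih =>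
    rintro K r n hn hK hK' Z rfl
    obtain ⟨L, f, e, hf, he, hac, hZ, hr⟩ :=
      exists_attach_acyclicAt K (m := n - 1) (by lia) Z p ⟨_, _, h⟩
    obtain ⟨Z', hZ'⟩ := hZ (K.isZero_of_isStrictlyGE n _) W k h
    -- The extension is zero on the cell: the cycle induced in `Y.X n` lifts, after a deflation, to
    -- `Y.X (n - 1) = 0`, and deflations are epimorphisms.
    obtain ⟨r', hr'⟩ := hr Y r 0 (by
      obtain ⟨T, t, y, ht, hy⟩ := hY (n - 1) n (n + 1) (by lia) rfl (p ≫ Z.ι ≫ r.f n)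
        (by simp [reassoc_of% Z.w])
      have := ht.epi
      rw [zero_comp, ← cancel_epi t, ← hy, (Y.isZero_of_isStrictlyGE a (n - 1)).eq_of_tgt y 0,
        zero_comp, comp_zero])
    obtain ⟨M, g, s, hg, hM, hM', hs, hs'⟩ := ih L r' (n - 1) (by lia) (by
      rw [CochainComplex.isStrictlyGE_iff]
      intro i hi
      have := hf i (by lia)
      exact IsZero.of_iso (K.isZero_of_isStrictlyGE n i) (asIso (f.f i)).symm) (fun j hj => by
        obtain rfl | hj := eq_or_ne j n
        · exact hac
        · exact (hK' j (by lia)).of_isIso f fun i hi => hf i (by lia)) Z' hZ'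
    refine ⟨M, f ≫ g, s, by rw [Category.assoc, hg, hr'], hM, hM',
      (isSplitWithComplement_of_iso_biprod f hB e hf he).comp hs, fun i hi => ?_⟩
    have := hf i (by lia)
    have := hs' i (by lia)
    rw [HomologicalComplex.comp_f]
    infer_instance

/-- A bounded complex over a locally exact complex `Y` embeds over `Y` into an acyclic bounded
complex, with a degreewise complement in `A`, if all objects have finite resolutions. -/
theorem exists_acyclic_of_isStrictlyGE (hA : ∀ X : E, ∃ (B : E) (p : B ⟶ X), A B ∧ IsDeflation p)
    (hA' : ∀ X : E, HasFiniteResolution A X)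
    {K Y : CochainComplex E ℤ} (hY : LocallyExact Y) (r : K ⟶ Y) (a b : ℤ) [K.IsStrictlyGE a]
    [K.IsStrictlyLE b] [Y.IsStrictlyGE a] :
    ∃ (L : CochainComplex E ℤ) (f : K ⟶ L) (r' : L ⟶ Y), f ≫ r' = r ∧ IsAcyclic L ∧
      (∃ c d, L.IsStrictlyGE c ∧ L.IsStrictlyLE d) ∧ IsSplitWithComplement A f := by
  obtain ⟨b', hb', hab⟩ : ∃ b', b ≤ b' ∧ a ≤ b' := ⟨max a b, by simp, by simp⟩
  have : K.IsStrictlyLE b' := K.isStrictlyLE_of_le b b' hb'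
  suffices h : ∀ K : Over Y, K.left.IsStrictlyLE b' → K.left.IsStrictlyGE a →
      ∃ (L : Over Y) (f : K ⟶ L), IsAcyclic L.left ∧
        (∃ c d, L.left.IsStrictlyGE c ∧ L.left.IsStrictlyLE d) ∧
        IsSplitWithComplement A f.left by
    obtain ⟨L, f, h₁, h₂, h₃⟩ := h (Over.mk r) (inferInstanceAs (K.IsStrictlyLE b'))
      (inferInstanceAs (K.IsStrictlyGE a))
    exact ⟨L.left, f.left, L.hom, Over.w f, h₁, h₂, h₃⟩
  intro K hK hK'
  obtain ⟨F, rfl, hF, hF'⟩ := exists_resolution_sequence hA hY K b'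
  obtain ⟨n, hn⟩ := Int.eq_ofNat_of_zero_le (show 0 ≤ b' - a by lia)
  obtain ⟨hs, hi⟩ := hF' 0 n (homOfLE (Nat.zero_le n))
  generalize F.map (homOfLE (Nat.zero_le n)) = φ at hs hi
  -- After `n = b' - a` stages the complex is acyclic in degrees above `a` and still zero below `a`,
  -- so only the cycles in degree `a` remain to be resolved.
  obtain ⟨Z⟩ := (hF n (a + 1) (by lia)).exists_cycles rfl
  have hge : (F.obj n).left.IsStrictlyGE a := by
    rw [CochainComplex.isStrictlyGE_iff]
    intro i hia
    have := hi i (Or.inr (by lia))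
    exact IsZero.of_iso ((F.obj 0).left.isZero_of_isStrictlyGE a i) (asIso (φ.left.f i)).symm
  obtain ⟨M, g, s, hg, hM, ⟨c, hc⟩, hs', hg'⟩ := exists_acyclic_of_hasFiniteResolution hY a
    (hA' Z.pt) (F.obj n).left (F.obj n).hom a le_rfl hge (fun j hj => hF n j (by lia)) Z rfl
  refine ⟨Over.mk s, φ ≫ Over.homMk g hg, hM, ⟨c, b', hc, ?_⟩, hs.comp hs'⟩
  rw [CochainComplex.isStrictlyLE_iff]
  intro i hib
  have := hi i (Or.inl (by simp; lia))
  have := hg' i (by lia)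
  exact IsZero.of_iso ((F.obj 0).left.isZero_of_isStrictlyLE b' i)
    (asIso (φ.left.f i) ≪≫ asIso (g.f i)).symm

end Main

/-! ### Locally exact complexes form a thick subcategory of the homotopy category -/

section LocallyExact

open CochainComplex HomComplex

variable {E : Type u} [Category.{v} E] [Preadditive E] [HasZeroObject E] [HasBinaryBiproducts E]
  [ConflationCategory E]

/-- Lift the image of the cycle in `Y`, map the lift back by `g`, and correct it by the homotopy. -/
lemma LocallyExact.of_homotopy_retract {X Y : CochainComplex E ℤ} (hY : LocallyExact Y)
    (f : X ⟶ Y) (g : Y ⟶ X) (h : Homotopy (f ≫ g) (𝟙 X)) : LocallyExact X := by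
  intro i j k hi hj T x hx
  obtain ⟨T', t, y, ht, hy⟩ := hY i j k hi hj (x ≫ f.f j) (by
    rw [Category.assoc, f.comm, reassoc_of% hx, zero_comp])
  refine ⟨T', t, y ≫ g.f i - t ≫ x ≫ h.hom j i, ht, ?_⟩
  have := h.comm j
  rw [dNext_eq h.hom (show (ComplexShape.up ℤ).Rel j k from hj),
    prevD_eq h.hom (show (ComplexShape.up ℤ).Rel i j from hi)] at this
  have h₁ : t ≫ x ≫ (f ≫ g).f j = t ≫ x ≫ h.hom j i ≫ X.d i j + t ≫ x := by
    rw [this]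
    simp [reassoc_of% hx]
  rw [Preadditive.sub_comp, Category.assoc, g.comm, reassoc_of% hy]
  simp only [HomologicalComplex.comp_f] at h₁
  simp [h₁]

/-- The `K`-component of a cycle of the cone is a cycle and lifts locally to `y₁`. Correcting the
`L`-component by `y₁ ≫ φ` turns it into a cycle, which lifts after a further deflation. -/
lemma LocallyExact.mappingCone [IsDeflationExact E] {K L : CochainComplex E ℤ} (φ : K ⟶ L)
    (hK : LocallyExact K) (hL : LocallyExact L) : LocallyExact (mappingCone φ) := by
  intro i j k hi hj T x hx
  have h₁ : (x ≫ (mappingCone.fst φ).1.v j k hj) ≫ K.d k (k + 1) = 0 := by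
    have := mappingCone.d_fst_v φ j k (k + 1) hj rfl
    rw [Category.assoc, ← neg_eq_zero, ← Preadditive.comp_neg, ← Preadditive.neg_comp]
    simp only [Preadditive.neg_comp, ← this]
    rw [reassoc_of% hx, zero_comp]
  obtain ⟨T₁, t₁, y₁, ht₁, hy₁⟩ := hK j k (k + 1) hj rfl _ h₁
  have h₂ : x ≫ (mappingCone.fst φ).1.v j k hj ≫ φ.f k +
      x ≫ (mappingCone.snd φ).v j j (add_zero j) ≫ L.d j k = 0 := by
    have := mappingCone.d_snd_v φ j k hj
    rw [← Preadditive.comp_add, ← this, reassoc_of% hx, zero_comp]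
  obtain ⟨T₂, t₂, y₂, ht₂, hy₂⟩ := hL i j k hi hj
    (t₁ ≫ x ≫ (mappingCone.snd φ).v j j (add_zero j) + y₁ ≫ φ.f j) (by
      rw [Preadditive.add_comp, Category.assoc, Category.assoc, Category.assoc, φ.comm,
        reassoc_of% hy₁, ← Preadditive.comp_add, add_comm, h₂, comp_zero])
  refine ⟨T₂, t₂ ≫ t₁, y₂ ≫ (mappingCone.inr φ).f i -
    t₂ ≫ y₁ ≫ (mappingCone.inl φ).v j i (by lia), ht₂.comp ht₁, ?_⟩
  rw [Preadditive.sub_comp, Category.assoc, Category.assoc, Category.assoc,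
    mappingCone.inl_v_d φ j i k (by lia) (by lia), mappingCone.inr_f_d, reassoc_of% hy₂,
    mappingCone.ext_to_iff _ j k hj]
  constructor
  · simp [reassoc_of% hy₁]
  · simp

lemma LocallyExact.shift {K : CochainComplex E ℤ} (hK : LocallyExact K) (n : ℤ) :
    LocallyExact (K⟦n⟧) := by
  intro i j k hi hj T x hx
  let x' : T ⟶ K.X (j + n) := x
  have hx' : n.negOnePow • (x' ≫ K.d (j + n) (k + n)) = 0 := by
    rw [← Linear.comp_units_smul]
    exact hx
  obtain ⟨T', t, y, ht, hy⟩ := hK (i + n) (j + n) (k + n) (by lia) (by lia) x'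
    ((smul_eq_zero_iff_eq _).1 hx')
  have hy' : (n.negOnePow • y) ≫ (n.negOnePow • K.d (i + n) (j + n)) = t ≫ x := by
    rw [Linear.comp_units_smul, Linear.units_smul_comp, smul_smul, Int.units_mul_self, one_smul]
    exact hy
  exact ⟨T', t, n.negOnePow • y, ht, hy'⟩

variable (E) in
/-- The locally exact complexes, as objects in the homotopy category. -/
def locallyExact : ObjectProperty (HomotopyCategory E (ComplexShape.up ℤ)) :=
  fun K => LocallyExact (E := E) K.as

instance : (locallyExact E).IsStableUnderRetracts where
  of_retract {X Y} r hY := by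
    obtain ⟨X, rfl⟩ := X.quotient_obj_surjective
    obtain ⟨Y, rfl⟩ := Y.quotient_obj_surjective
    obtain ⟨f, hf⟩ := (HomotopyCategory.quotient E (ComplexShape.up ℤ)).map_surjective r.i
    obtain ⟨g, hg⟩ := (HomotopyCategory.quotient E (ComplexShape.up ℤ)).map_surjective r.r
    exact LocallyExact.of_homotopy_retract hY f g (HomotopyCategory.homotopyOfEq _ _
      ((Functor.map_comp _ f g).trans (by
        rw [hf, hg, r.retract]
        exact (CategoryTheory.Functor.map_id _ X).symm)))

variable [IsDeflationExact E]

instance : (locallyExact E).ContainsZero where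
  exists_zero := ⟨(HomotopyCategory.quotient _ _).obj 0, Functor.map_isZero _ (isZero_zero _),
    locallyExact_of_isZero fun i => (HomologicalComplex.eval E _ i).map_isZero (isZero_zero _)⟩

instance : (locallyExact E).IsStableUnderShift ℤ where
  isStableUnderShiftBy n := ⟨fun K hK => by
    obtain ⟨K, rfl⟩ := K.quotient_obj_surjective
    rw [ObjectProperty.prop_shift_iff, HomotopyCategory.shift_quotient_obj]
    exact LocallyExact.shift hK n⟩

instance : (locallyExact E).IsTriangulatedClosed₃ where
  ext₃' T hT h₁ h₂ := by
    obtain ⟨f, ⟨e⟩⟩ := exists_iso_mappingCone E T hT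
    exact ⟨_, LocallyExact.mappingCone f h₁ h₂, ⟨e⟩⟩

instance : (locallyExact E).IsTriangulated where
  toIsTriangulatedClosed₂ := .of_isTriangulatedClosed₃

end LocallyExact

/-! ### The triangle of a degreewise split inclusion -/

section Split

variable {E : Type u} [Category.{v} E] [Preadditive E] [HasZeroObject E] [HasBinaryBiproducts E]

/-- The cone of a degreewise split inclusion with complement in `A` is homotopy equivalent to a
complex with objects in `A`. -/
lemma IsSplitWithComplement.exists_cone {A : ObjectProperty E} {K L : CochainComplex E ℤ}
    {f : K ⟶ L} (hf : IsSplitWithComplement A f) :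
    ∃ Q : CochainComplex E ℤ, (∀ i, A (Q.X i)) ∧ (∀ i, IsZero (L.X i) → IsZero (Q.X i)) ∧
      ∀ (T : Triangle (HomotopyCategory E (ComplexShape.up ℤ))) (_ : T ∈ distTriang _)
        (e₁ : T.obj₁ ≅ (HomotopyCategory.quotient _ _).obj K)
        (e₂ : T.obj₂ ≅ (HomotopyCategory.quotient _ _).obj L),
        T.mor₁ ≫ e₂.hom = e₁.hom ≫ (HomotopyCategory.quotient _ _).map f →
        Nonempty (T.obj₃ ≅ (HomotopyCategory.quotient _ _).obj Q) := by
  choose Q e hQ he using hf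
  have hs : ∀ i, biprod.inl ≫ (e i).inv = f.f i := fun i => by simp [← he i]
  have hid : ∀ i, (e i).hom ≫ biprod.snd ≫ biprod.inr ≫ (e i).inv =
      𝟙 _ - (e i).hom ≫ biprod.fst ≫ f.f i := fun i => by
    rw [← hs, eq_sub_iff_add_eq, ← cancel_epi (e i).inv, ← cancel_mono (e i).hom]
    ext <;> simp
  have hfs : ∀ i, f.f i ≫ (e i).hom ≫ biprod.snd = 0 := fun i => by simp [reassoc_of% he i]
  have hd : ∀ i j, (e i).hom ≫ biprod.snd ≫ biprod.inr ≫ (e i).inv ≫ L.d i j ≫ (e j).hom ≫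
      biprod.snd = L.d i j ≫ (e j).hom ≫ biprod.snd := fun i j => by
    rw [reassoc_of% hid i, Preadditive.sub_comp, Category.assoc, Category.assoc, f.comm_assoc,
      hfs, comp_zero, comp_zero, comp_zero, sub_zero, Category.id_comp]
  have h₁ : ∀ i, f.f i ≫ (e i).hom ≫ biprod.fst = 𝟙 _ := fun i => by simp [reassoc_of% he i]
  have h₂ : ∀ i, (biprod.inr ≫ (e i).inv) ≫ (e i).hom ≫ biprod.snd = 𝟙 _ := fun i => by simp
  have h₃ : ∀ i, ((e i).hom ≫ biprod.fst) ≫ f.f i +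
      ((e i).hom ≫ biprod.snd) ≫ biprod.inr ≫ (e i).inv = 𝟙 _ := fun i => by simp [hid]
  -- The complements form the quotient complex of `L` by `K`: as `f` is a chain map, the component
  -- of the differential from `K` to the complement is zero.
  let M : CochainComplex E ℤ :=
    { X := Q
      d := fun i j => biprod.inr ≫ (e i).inv ≫ L.d i j ≫ (e j).hom ≫ biprod.snd
      shape := fun i j hij => by simp [L.shape i j hij]
      d_comp_d' := fun i j k _ _ => by simp [hd] }
  let g : L ⟶ M :=
    { f := fun i => (e i).hom ≫ biprod.snd
      comm' := fun i j _ => by simp [M, hd] }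
  let S : ShortComplex (CochainComplex E ℤ) := ShortComplex.mk f g (by ext i; exact hfs i)
  let σ : ∀ n, (S.map (HomologicalComplex.eval E _ n)).Splitting := fun n =>
    { r := (e n).hom ≫ biprod.fst
      s := biprod.inr ≫ (e n).inv
      f_r := h₁ n
      s_g := h₂ n
      id := h₃ n }
  refine ⟨M, hQ, fun i hi => ?_, fun T hT e₁ e₂ h => ?_⟩
  · exact IsZero.of_mono (biprod.inr ≫ (e i).inv) hi
  · exact ⟨Triangle.π₃.mapIso (isoTriangleOfIso₁₂ T
      (CochainComplex.trianglehOfDegreewiseSplit S σ) hT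
      ((HomotopyCategory.distinguished_iff_iso_trianglehOfDegreewiseSplit _).2
        ⟨S, σ, ⟨Iso.refl _⟩⟩) e₁ e₂ h)⟩

end Split

/-! ### Complexes in a preresolving subcategory -/

section Preresolving

variable {E : Type u} [Category.{v} E] [Preadditive E] [HasZeroObject E] [HasBinaryBiproducts E]
  [ConflationCategory E] {A : ObjectProperty E}

lemma HasFiniteResolution.of_iso {X Y : E} (h : HasFiniteResolution A X) (e : X ≅ Y) :
    HasFiniteResolution A Y := by
  cases h with
  | of_isZero h => exact .of_isZero (h.of_iso e.symm)
  | of_isConflation i p h hB hK =>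
    refine .of_isConflation i (p ≫ e.hom) ⟨by simp [reassoc_of% h.zero], ?_⟩ hB hK
    exact ConflationCategory.of_iso (S := ShortComplex.mk i p h.zero)
      (ShortComplex.isoMk (Iso.refl _) (Iso.refl _) e) h.choose_spec

/-- Cut the resolution into conflations between consecutive cycles, starting from degree `-n`, where
the cycles vanish. In degree `1` the cycles are the whole term, isomorphic to `X`. -/
lemma IsFinitelyPreresolving.hasFiniteResolution [IsDeflationExact E]
    (hA : IsFinitelyPreresolving A) (X : E) : HasFiniteResolution A X := by
  obtain ⟨n, hn⟩ := iInf_lt_iff.1 (hA.resDim_lt_top X)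
  obtain ⟨⟨K, hK, ⟨e⟩, hK₁, hK₂⟩, -⟩ := iInf_lt_iff.1 hn
  rw [isAcyclic_iff] at hK
  choose Z hZ using hK
  choose p hp fac using hZ
  have h : ∀ m : ℕ, m ≤ n + 1 → HasFiniteResolution A (Z (m - n)).pt := by
    intro m
    induction m with
    | zero =>
      intro _
      have := (hp ((0 : ℕ) - n : ℤ) ((0 : ℕ) - n - 1 : ℤ) (sub_add_cancel _ _)).epi
      exact .of_isZero (IsZero.of_epi (p ((0 : ℕ) - n : ℤ) ((0 : ℕ) - n - 1 : ℤ) (sub_add_cancel _ _))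
        (hK₂ _ (Or.inl (by simp))))
    | succ m hm =>
      intro h
      have hk : (m - n : ℤ) + 1 = (m + 1 : ℕ) - n := by lia
      exact .of_isConflation _ _ ((Z (m - n)).isConflation hk (Z _) (hp _ _ hk) (fac _ _ hk))
        (hK₁ _ (by lia) (by lia)) (hm (by lia))
  have h₁ := h (n + 1) le_rfl
  have hn : ((n + 1 : ℕ) : ℤ) - n = 1 := by lia
  rw [hn] at h₁
  have := (Z 1).mono_ι
  obtain ⟨s, hs⟩ := (Z 1).exists_lift (𝟙 _) ((hK₂ 2 (Or.inr (by lia))).eq_of_tgt _ _)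
  let e' : (Z 1).pt ≅ X := ⟨(Z 1).ι, s, by rw [← cancel_mono (Z 1).ι]; simp [hs], hs⟩ ≪≫ e
  exact h₁.of_iso e'

variable [A.ContainsZero]

namespace IsPreresolving

/-- An isomorphism onto `Y` is a kernel of the deflation from `Y` to a zero object, so closure under
kernels of deflations makes `A` replete. -/
lemma prop_of_iso [IsDeflationExact E] (hA : IsPreresolving A) {X Y : E} (e : X ≅ Y) (hY : A Y) :
    A X := by
  obtain ⟨Z, h0, hZ⟩ := A.exists_prop_of_containsZero
  refine hA.deflation_closed e.hom (0 : Y ⟶ Z)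
    ((IsDeflationExact.deflation_to_zero _ h0).isConflation comp_zero
      (KernelFork.IsLimit.ofι' _ _ fun x _ => ⟨x ≫ e.inv, by simp⟩)) hY hZ

lemma prop_of_isZero [IsDeflationExact E] (hA : IsPreresolving A) {X : E} (hX : IsZero X) : A X := by
  obtain ⟨Z, h0, hZ⟩ := A.exists_prop_of_containsZero
  exact hA.prop_of_iso (hX.iso h0) hZ

end IsPreresolving

variable [A.IsClosedUnderBinaryProducts]

lemma isConflation_map_ι {X Y Z : A.FullSubcategory} {f : X ⟶ Y} {g : Y ⟶ Z}
    (h : IsConflation f g) : IsConflation f.hom g.hom :=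
  ⟨by simpa using congr_arg (fun φ => A.ι.map φ) h.zero, h.choose_spec⟩

lemma isConflation_homMk {X Y Z : A.FullSubcategory} {f : X.obj ⟶ Y.obj} {g : Y.obj ⟶ Z.obj}
    (h : IsConflation f g) : IsConflation (A.homMk f : X ⟶ Y) (A.homMk g : Y ⟶ Z) :=
  ⟨by ext; exact h.zero, h.choose_spec⟩

/-- An acyclic complex in a full subcategory is locally exact in the ambient category. -/
lemma IsAcyclic.locallyExact_map_ι [IsDeflationExact E] {K : CochainComplex A.FullSubcategory ℤ}
    (hK : IsAcyclic K) : LocallyExact ((A.ι.mapHomologicalComplex (ComplexShape.up ℤ)).obj K) := by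
  rw [isAcyclic_iff] at hK
  intro i j k hi hj T (x : T ⟶ (K.X j).obj) (hx : x ≫ (K.d j k).hom = 0)
  obtain ⟨Z, hZ⟩ := hK j
  obtain ⟨p, hp, fac⟩ := hZ i hi
  obtain ⟨Z', hZ'⟩ := hK k
  obtain ⟨p', hp', fac'⟩ := hZ' j hj
  obtain ⟨Z'', hZ''⟩ := hK (k + 1)
  obtain ⟨p'', hp'', fac''⟩ := hZ'' k rfl
  -- A kernel in `A` tests only objects of `A`, while `T` lies in `E`; the cycle inclusions belong
  -- to conflations, hence are kernels in `E` too.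
  obtain ⟨hl⟩ := (isConflation_map_ι (Z'.isConflation rfl Z'' hp'' fac'')).nonempty_isLimit
  obtain ⟨hl'⟩ := (isConflation_map_ι (Z.isConflation hj Z' hp' fac')).nonempty_isLimit
  have h₀ : x ≫ p'.hom = 0 := Fork.IsLimit.hom_ext hl (by
    have : (x ≫ p'.hom) ≫ Z'.ι.hom = 0 := by
      rw [Category.assoc, ← ObjectProperty.FullSubcategory.comp_hom, fac', hx]
    exact this.trans zero_comp.symm)
  obtain ⟨u, hu⟩ := KernelFork.IsLimit.lift' hl' x h₀
  have hu : u ≫ Z.ι.hom = x := hu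
  obtain ⟨W, q, hq⟩ := hp
  have hp : IsDeflation p.hom := ⟨_, _, isConflation_map_ι hq⟩
  obtain ⟨T', t, y, ht, hy⟩ := hp.exists_lift u
  refine ⟨T', t, y, ht, ?_⟩
  have h₁ : p.hom ≫ Z.ι.hom = (K.d i j).hom := by
    rw [← ObjectProperty.FullSubcategory.comp_hom, fac]
  change y ≫ (K.d i j).hom = t ≫ x
  rw [← h₁, reassoc_of% hy, hu]

namespace IsPreresolving

/-- A bounded above complex in `A` is acyclic in `A` if it is acyclic in `E`. -/
lemma isAcyclic [IsDeflationExact E] (hA : IsPreresolving A) {K : CochainComplex A.FullSubcategory ℤ}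
    (hK : IsAcyclic ((A.ι.mapHomologicalComplex (ComplexShape.up ℤ)).obj K)) (b : ℤ)
    (hb : ∀ i, b < i → IsZero (K.X i).obj) : IsAcyclic K := by
  rw [isAcyclic_iff] at hK ⊢
  choose Z hZ using hK
  choose p hp fac using hZ
  have hc : ∀ j k (hk : j + 1 = k), IsConflation (Z j).ι (p k j hk) := fun j k hk =>
    (Z j).isConflation hk (Z k) (hp _ _ _) (fac _ _ _)
  -- Descending induction on the degree: the cycles vanish above `b`, and each earlier cycle object
  -- is the kernel of a deflation between objects of `A`.
  have hAZ : ∀ (n : ℕ) j, b < j + n → A (Z j).pt := by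
    intro n
    induction n with
    | zero =>
      intro j hj
      have := (Z j).mono_ι
      exact hA.prop_of_isZero (IsZero.of_mono (Z j).ι (hb j (by simpa using hj)))
    | succ n hn =>
      intro j hj
      exact hA.deflation_closed _ _ (hc j (j + 1) rfl) (K.X j).property
        (hn (j + 1) (by push_cast at hj; lia))
  have hAZ' : ∀ j, A (Z j).pt := fun j => hAZ (b - j + 1).toNat j (by lia)
  intro j
  let ι : (⟨(Z j).pt, hAZ' j⟩ : A.FullSubcategory) ⟶ K.X j := A.homMk (Z j).ι
  have : Mono ι := ⟨fun u v h => by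
    have := (Z j).mono_ι
    ext
    have h := congr_arg (fun φ => A.ι.map φ) h
    exact (cancel_mono (Z j).ι).1 h⟩
  refine ⟨.ofMono ι (by ext; exact (Z j).w) fun T x hx => ?_, fun i hi => ?_⟩
  · obtain ⟨u, hu⟩ := (Z j).exists_lift x.hom (congr_arg (fun φ => A.ι.map φ) hx)
    exact ⟨A.homMk u, by ext; exact hu⟩
  · exact ⟨A.homMk (p j i hi),
      ⟨⟨_, hAZ' i⟩, A.homMk (Z i).ι, isConflation_homMk (hc i j hi)⟩, by ext; exact fac j i hi⟩

end IsPreresolving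

end Preresolving

/-! ### Comparison of the homotopy categories of complexes -/

section Comparison

variable {E : Type u} [Category.{v} E] [Preadditive E] [HasZeroObject E] [HasBinaryBiproducts E]
  [ConflationCategory E]

instance {C : Type*} [Category* C] {D : Type*} [Category* D] (P : ObjectProperty D)
    [P.IsStableUnderRetracts] (F : C ⥤ D) : (P.inverseImage F).IsStableUnderRetracts where
  of_retract r hY := P.prop_of_retract (r.map F) hY

variable (E) in
/-- The acyclic complexes, as objects in the homotopy category. -/
def acyclic : ObjectProperty (HomotopyCategory E (ComplexShape.up ℤ)) :=
  fun K => IsAcyclic (C := E) K.as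

/-- Every morphism from a complex in `P` to a locally exact complex in `P` extends to an acyclic
complex in `P` along a degreewise split monomorphism with complements in `A`. -/
def HasAcyclicExtensions (A : ObjectProperty E)
    (P : ObjectProperty (HomotopyCategory E (ComplexShape.up ℤ))) : Prop :=
  ∀ ⦃K Y : CochainComplex E ℤ⦄ (r : K ⟶ Y), P ((HomotopyCategory.quotient _ _).obj K) →
    P ((HomotopyCategory.quotient _ _).obj Y) → LocallyExact Y →
    ∃ (L : CochainComplex E ℤ) (f : K ⟶ L) (r' : L ⟶ Y), f ≫ r' = r ∧ IsAcyclic L ∧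
      P ((HomotopyCategory.quotient _ _).obj L) ∧ IsSplitWithComplement A f

variable [IsDeflationExact E]

/-- A full subcategory of the homotopy category of `E` in which a retract of a locally exact
complex is a retract of an acyclic one. -/
lemma thickClosure_acyclic_eq (P : ObjectProperty (HomotopyCategory E (ComplexShape.up ℤ)))
    [P.IsTriangulated] (hP : HasAcyclicExtensions ⊤ P) :
    thickClosure ((acyclic E).inverseImage P.ι) = (locallyExact E).inverseImage P.ι := by
  apply le_antisymm
  · exact thickClosure_le _ _ fun K hK => IsAcyclic.locallyExact hK
  · rintro ⟨⟨K⟩, hK⟩ h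
    -- Extending the identity of the locally exact `K` exhibits it as a retract of an acyclic
    -- complex.
    obtain ⟨L, f, r, fac, hL, hL', -⟩ := hP (𝟙 K) hK hK h
    have hL'' : thickClosure ((acyclic E).inverseImage P.ι) ⟨_, hL'⟩ := le_thickClosure _ _ hL
    refine ObjectProperty.prop_of_retract _ (?_ : Retract (⟨⟨K⟩, hK⟩ : P.FullSubcategory) ⟨_, hL'⟩) hL''
    exact
      { i := P.homMk ((HomotopyCategory.quotient E _).map f)
        r := P.homMk ((HomotopyCategory.quotient E _).map r)
        retract := by
          ext
          exact ((HomotopyCategory.quotient E _).map_comp f r).symm.trans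
            ((congr_arg _ fac).trans ((HomotopyCategory.quotient E _).map_id K)) }

variable {A : ObjectProperty E} [A.ContainsZero] [A.IsClosedUnderBinaryProducts]
  (P : ObjectProperty (HomotopyCategory E (ComplexShape.up ℤ)))
  (PA : ObjectProperty (HomotopyCategory A.FullSubcategory (ComplexShape.up ℤ))) [PA.IsTriangulated]

/-- As in the ambient case, a locally exact `K` is a retract of an acyclic `L`. Complements in `A`
put all terms of `L` in `A`, and since `L` is bounded above, preresolvability makes it acyclic in
`A` as well. -/
lemma thickClosure_acyclic_eq_inverseImage (hA : IsPreresolving A) (hP : HasAcyclicExtensions A P)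
    (hPA : ∀ K, PA K ↔ P ((A.ι.mapHomotopyCategory _).obj K)) (hm : P ≤ minus E) :
    thickClosure ((acyclic A.FullSubcategory).inverseImage PA.ι) =
      (locallyExact E).inverseImage (PA.ι ⋙ A.ι.mapHomotopyCategory _) := by
  apply le_antisymm
  · exact thickClosure_le _ _ fun K hK => IsAcyclic.locallyExact_map_ι hK
  · rintro ⟨⟨K⟩, hK⟩ h
    obtain ⟨L, f, r, fac, hL, hL', hf⟩ :=
      hP (𝟙 ((A.ι.mapHomologicalComplex (ComplexShape.up ℤ)).obj K)) ((hPA _).1 hK) ((hPA _).1 hK) h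
    obtain ⟨b, hb⟩ := hm _ hL'
    have : L.IsStrictlyLE b := hb
    let L' : CochainComplex A.FullSubcategory ℤ :=
      HomologicalComplex.liftObjectProperty A L fun i => hf.prop_X i (K.X i).property
    have hL₀ : IsAcyclic L' := hA.isAcyclic (K := L') hL b
      fun i hi => CochainComplex.isZero_of_isStrictlyLE L b i hi
    let f' : K ⟶ L' := { f i := A.homMk (f.f i), comm' i j _ := by ext; exact f.comm i j }
    let r' : L' ⟶ K := { f i := A.homMk (r.f i), comm' i j _ := by ext; exact r.comm i j }
    have fac' : f' ≫ r' = 𝟙 K := by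
      ext i
      exact HomologicalComplex.congr_hom fac i
    have hL'' : thickClosure ((acyclic A.FullSubcategory).inverseImage PA.ι)
        ⟨(HomotopyCategory.quotient _ _).obj L', (hPA _).2 hL'⟩ := le_thickClosure _ _ hL₀
    refine ObjectProperty.prop_of_retract _ (?_ : Retract (⟨⟨K⟩, hK⟩ : PA.FullSubcategory) _) hL''
    exact
      { i := ObjectProperty.homMk ((HomotopyCategory.quotient _ _).map f')
        r := ObjectProperty.homMk ((HomotopyCategory.quotient _ _).map r')
        retract := by
          ext
          exact ((HomotopyCategory.quotient _ _).map_comp f' r').symm.trans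
            ((congr_arg _ fac').trans ((HomotopyCategory.quotient _ _).map_id K)) }

variable [P.IsTriangulated] (h : ∀ K : PA.FullSubcategory, P ((PA.ι ⋙ A.ι.mapHomotopyCategory _).obj K))

/-- Embed `K` in an acyclic `L` with complements in `A`. The cone is a complex `Q` over `A`, and
rotating back gives `Q⟦-1⟧ ⟶ K` with cone `L`. -/
lemma exists_trW_locallyExact (hP : HasAcyclicExtensions A P)
    (hPA : ∀ K, PA K ↔ P ((A.ι.mapHomotopyCategory _).obj K))
    (hP' : ∀ K L : CochainComplex E ℤ, (∀ i, IsZero (K.X i) → IsZero (L.X i)) →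
      P ((HomotopyCategory.quotient _ _).obj K) → P ((HomotopyCategory.quotient _ _).obj L))
    (Y : P.FullSubcategory) :
    ∃ (X : PA.FullSubcategory) (s : (P.lift (PA.ι ⋙ A.ι.mapHomotopyCategory _) h).obj X ⟶ Y),
      ((locallyExact E).inverseImage P.ι).trW s := by
  obtain ⟨⟨K⟩, hK⟩ := Y
  have h0 (i : ℤ) : IsZero ((0 : CochainComplex E ℤ).X i) :=
    Functor.map_isZero (HomologicalComplex.eval E _ i) (isZero_zero _)
  obtain ⟨L, f, -, -, hL, hL', hf⟩ := hP (0 : K ⟶ 0) hK (hP' K 0 (fun i _ => h0 i) hK)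
    (locallyExact_of_isZero h0)
  obtain ⟨Q, hQ, hQL, hT⟩ := hf.exists_cone
  let f' : (⟨⟨K⟩, hK⟩ : P.FullSubcategory) ⟶ ⟨(HomotopyCategory.quotient _ _).obj L, hL'⟩ :=
    P.homMk ((HomotopyCategory.quotient E _).map f)
  obtain ⟨Z, g, δ, mem⟩ := distinguished_cocone_triangle f'
  obtain ⟨e⟩ := hT _ (P.ι.map_distinguished _ mem) (Iso.refl _) (Iso.refl _)
    ((Category.comp_id _).trans (Category.id_comp _).symm)
  let F := P.lift (PA.ι ⋙ A.ι.mapHomotopyCategory _) h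
  let Q' : CochainComplex A.FullSubcategory ℤ := HomologicalComplex.liftObjectProperty A Q hQ
  have hQ' : PA ((HomotopyCategory.quotient _ _).obj Q') := (hPA _).2 (hP' L Q hQL hL')
  have hZ : F.essImage Z := ⟨⟨_, hQ'⟩, ⟨P.fullyFaithfulι.preimageIso e.symm⟩⟩
  obtain ⟨X, ⟨e'⟩⟩ := F.essImage.le_shift (-1 : ℤ) _ hZ
  let T := (Triangle.mk f' g δ).invRotate
  have hs : ((locallyExact E).inverseImage P.ι).trW T.mor₁ :=
    ⟨_, _, _, inv_rot_of_distTriang _ mem, hL.locallyExact⟩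
  exact ⟨X, e'.hom ≫ T.mor₁, (MorphismProperty.cancel_left_of_respectsIso _ _ _).2 hs⟩

/-- The equivalence of Verdier quotients, for a class `P` of complexes in `E` and the
corresponding class `PA` of complexes in `A`. -/
theorem exists_equivalence_of_hasAcyclicExtensions (hA : IsPreresolving A)
    (hP : HasAcyclicExtensions A P) (hP₀ : HasAcyclicExtensions ⊤ P)
    (hPA : ∀ K, PA K ↔ P ((A.ι.mapHomotopyCategory _).obj K)) (hm : P ≤ minus E)
    (hP' : ∀ K L : CochainComplex E ℤ, (∀ i, IsZero (K.X i) → IsZero (L.X i)) →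
      P ((HomotopyCategory.quotient _ _).obj K) → P ((HomotopyCategory.quotient _ _).obj L)) :
    ∃ (Φ : (thickClosure ((acyclic A.FullSubcategory).inverseImage PA.ι)).trW.Localization ⥤
        (thickClosure ((acyclic E).inverseImage P.ι)).trW.Localization) (_ : Φ.CommShift ℤ)
      (e : (thickClosure ((acyclic A.FullSubcategory).inverseImage PA.ι)).trW.Q ⋙ Φ ≅
        P.lift (PA.ι ⋙ A.ι.mapHomotopyCategory _) h ⋙
          (thickClosure ((acyclic E).inverseImage P.ι)).trW.Q),
      NatTrans.CommShift e.hom ℤ ∧ Φ.IsTriangulated ∧ Φ.IsEquivalence := by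
  refine exists_equivalence_verdierQuotient _ _ (P.lift (PA.ι ⋙ A.ι.mapHomotopyCategory _) h) ?_ ?_
  · rw [thickClosure_acyclic_eq_inverseImage P PA hA hP hPA hm, thickClosure_acyclic_eq P hP₀]
    rfl
  · rw [thickClosure_acyclic_eq P hP₀]
    exact exists_trW_locallyExact P PA h hP hPA hP'

end Comparison

/-! ### Bounded above and bounded complexes -/

section Boundedness

variable {E : Type u} [Category.{v} E] [Preadditive E]

lemma minus_of_isZero (K L : CochainComplex E ℤ) (h : ∀ i, IsZero (K.X i) → IsZero (L.X i))
    (hK : minus E ((HomotopyCategory.quotient _ _).obj K)) :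
    minus E ((HomotopyCategory.quotient _ _).obj L) := by
  obtain ⟨b, hb⟩ := (minus_quotient_obj_iff K).1 hK
  exact ⟨b, (CochainComplex.isStrictlyLE_iff L b).2
    fun i hi => h i (K.isZero_of_isStrictlyLE b i hi)⟩

lemma bounded_of_isZero (K L : CochainComplex E ℤ) (h : ∀ i, IsZero (K.X i) → IsZero (L.X i))
    (hK : bounded E ((HomotopyCategory.quotient _ _).obj K)) :
    bounded E ((HomotopyCategory.quotient _ _).obj L) := by
  obtain ⟨a, b, ha, hb⟩ := (bounded_quotient_obj_iff K).1 hK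
  exact ⟨a, b, (CochainComplex.isStrictlyGE_iff L a).2
      fun i hi => h i (K.isZero_of_isStrictlyGE a i hi),
    (CochainComplex.isStrictlyLE_iff L b).2 fun i hi => h i (K.isZero_of_isStrictlyLE b i hi)⟩

lemma isZero_fullSubcategory_iff {C : Type u} [Category.{v} C] [HasZeroMorphisms C]
    {A : ObjectProperty C} (X : A.FullSubcategory) : IsZero X ↔ IsZero X.obj := by
  rw [IsZero.iff_id_eq_zero, IsZero.iff_id_eq_zero]
  exact ⟨fun h => congr_arg (fun φ => A.ι.map φ) h, fun h => by ext; exact h⟩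

lemma minus_map_ι_iff {A : ObjectProperty E}
    (K : HomotopyCategory A.FullSubcategory (ComplexShape.up ℤ)) :
    minus A.FullSubcategory K ↔ minus E ((A.ι.mapHomotopyCategory _).obj K) := by
  obtain ⟨K⟩ := K
  refine exists_congr fun b => (CochainComplex.isStrictlyLE_iff _ b).trans
    (Iff.trans ?_ (CochainComplex.isStrictlyLE_iff _ b).symm)
  exact forall₂_congr fun i _ => isZero_fullSubcategory_iff (K.X i)

lemma bounded_map_ι_iff {A : ObjectProperty E}
    (K : HomotopyCategory A.FullSubcategory (ComplexShape.up ℤ)) :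
    bounded A.FullSubcategory K ↔ bounded E ((A.ι.mapHomotopyCategory _).obj K) := by
  obtain ⟨K⟩ := K
  refine exists₂_congr fun a b => and_congr ?_ ?_
  · refine (CochainComplex.isStrictlyGE_iff _ a).trans
      (Iff.trans ?_ (CochainComplex.isStrictlyGE_iff _ a).symm)
    exact forall₂_congr fun i _ => isZero_fullSubcategory_iff (K.X i)
  · refine (CochainComplex.isStrictlyLE_iff _ b).trans
      (Iff.trans ?_ (CochainComplex.isStrictlyLE_iff _ b).symm)
    exact forall₂_congr fun i _ => isZero_fullSubcategory_iff (K.X i)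

variable [HasZeroObject E] [HasBinaryBiproducts E] [ConflationCategory E] [IsDeflationExact E]

lemma hasAcyclicExtensions_minus (A : ObjectProperty E) [A.ContainsZero]
    [A.IsClosedUnderBinaryProducts] (hA : ∀ X : E, ∃ (B : E) (p : B ⟶ X), A B ∧ IsDeflation p) :
    HasAcyclicExtensions A (minus E) := by
  intro K Y r hK _ hY
  obtain ⟨b, hb⟩ := (minus_quotient_obj_iff K).1 hK
  obtain ⟨L, f, r', fac, hL, hL', hf⟩ := exists_acyclic_of_isStrictlyLE hA hY r b
  exact ⟨L, f, r', fac, hL, ⟨b, hL'⟩, hf⟩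

lemma hasAcyclicExtensions_bounded (A : ObjectProperty E) [A.ContainsZero]
    [A.IsClosedUnderBinaryProducts] (hA : ∀ X : E, ∃ (B : E) (p : B ⟶ X), A B ∧ IsDeflation p)
    (hA' : ∀ X : E, HasFiniteResolution A X) : HasAcyclicExtensions A (bounded E) := by
  intro K Y r hK hY' hY
  obtain ⟨a₁, b, _, _⟩ := (bounded_quotient_obj_iff K).1 hK
  obtain ⟨a₂, _, _, _⟩ := (bounded_quotient_obj_iff Y).1 hY'
  have := K.isStrictlyGE_of_ge (min a₁ a₂) a₁ (min_le_left _ _)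
  have := Y.isStrictlyGE_of_ge (min a₁ a₂) a₂ (min_le_right _ _)
  obtain ⟨L, f, r', fac, hL, hL', hf⟩ :=
    exists_acyclic_of_isStrictlyGE hA hA' hY r (min a₁ a₂) b
  exact ⟨L, f, r', fac, hL, hL', hf⟩

lemma exists_isDeflation_top (X : E) :
    ∃ (B : E) (p : B ⟶ X), (⊤ : ObjectProperty E) B ∧ IsDeflation p :=
  ⟨X, 𝟙 X, trivial, isDeflation_of_isIso _⟩

/-- Each object resolves itself, with kernel zero. This makes the extension results available over
`E` itself, to identify its thick closure. -/
lemma hasFiniteResolution_top (X : E) : HasFiniteResolution ⊤ X := by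
  obtain ⟨K, i, h⟩ := isDeflation_of_isIso (𝟙 X)
  refine .of_isConflation i (𝟙 X) h trivial (.of_isZero ?_)
  obtain ⟨hl⟩ := h.nonempty_isLimit
  rw [IsZero.iff_id_eq_zero]
  refine Fork.IsLimit.hom_ext hl ?_
  have hi : i = 0 := by simpa using h.zero
  change 𝟙 K ≫ i = 0 ≫ i
  simp [hi]

end Boundedness

end OneSidedExact

theorem theorem3p5 {E : Type u} [Category.{v} E] [Preadditive E] [HasZeroObject E]
    [HasBinaryBiproducts E] [ConflationCategory E] [IsDeflationExact E]
    (A : ObjectProperty E) [A.ContainsZero] [A.IsClosedUnderBinaryProducts] :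
    (IsPreresolving A →
      ∃ (Φ : DMinus A.FullSubcategory ⥤ DMinus E) (_ : Φ.CommShift ℤ)
        (e : QMinus A.FullSubcategory ⋙ Φ ≅ mapKMinus A.ι ⋙ QMinus E),
        NatTrans.CommShift e.hom ℤ ∧ Φ.IsTriangulated ∧ Φ.IsEquivalence) ∧
    (IsFinitelyPreresolving A →
      ∃ (Φ : DBounded A.FullSubcategory ⥤ DBounded E) (_ : Φ.CommShift ℤ)
        (e : QBounded A.FullSubcategory ⋙ Φ ≅ mapKBounded A.ι ⋙ QBounded E),
        NatTrans.CommShift e.hom ℤ ∧ Φ.IsTriangulated ∧ Φ.IsEquivalence) := by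
  refine ⟨fun hA => ?_, fun hA => ?_⟩
  · exact exists_equivalence_of_hasAcyclicExtensions (minus E) (minus A.FullSubcategory)
      (fun K => (minus_map_ι_iff _).1 K.property) hA
      (hasAcyclicExtensions_minus A hA.exists_deflation)
      (hasAcyclicExtensions_minus ⊤ exists_isDeflation_top) minus_map_ι_iff le_rfl minus_of_isZero
  · exact exists_equivalence_of_hasAcyclicExtensions (bounded E) (bounded A.FullSubcategory)
      (fun K => (bounded_map_ι_iff _).1 K.property) hA.toIsPreresolving
      (hasAcyclicExtensions_bounded A hA.exists_deflation hA.hasFiniteResolution)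
      (hasAcyclicExtensions_bounded ⊤ exists_isDeflation_top hasFiniteResolution_top)
      bounded_map_ι_iff (fun K ⟨_, b, _, hb⟩ => ⟨b, hb⟩) bounded_of_isZero
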